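/- **Conventions.** Let $k$ be a field. For a $\mathbb Z$-graded $k$-vector space write $|x|'=|x|-1$ for the shifted degree, and $|\vec x|'$ for the sum of the shifted degrees of the entries of a list $\vec x$. All signs below are Koszul signs with respect to shifted degrees. An *$A_\infty$-algebra* is a graded vector space $A$ with multilinear operations $m_n:A^{\otimes n}\to A$, $n\ge 1$, of shifted degree $1$, such that $\sum \pm\, m(x_1,\dots,m(x_{i+1},\dots,x_j),\dots,x_n)=0$. Its cohomology is $H^\bullet(A)=\ker m_1/\operatorname{im} m_1$. An *$A_\infty$-morphism* $f:A\to B$ is a family $f_n:A^{\otimes n}\to B$, $n\ge1$, of shifted degree $0$ with $\sum\pm f(x_1,\dots,m(x_{i+1},\dots,x_j),\dots,x_n)=\sum m(f(x_1,\dots,x_{i_1}),\dots,f(x_{i_{r-1}+1},\dots,x_n))$; it is a *quasi-isomorphism* if $f_1$ induces an isomorphism on cohomology. An *$A_\infty$-bimodule map* $\phi:A\to A^*$ of degree $D\in\mathbb Z$ (with respect to shifted degrees) is a family of multilinear maps $\phi_{p,q}:A^{\otimes p}\otimes \underline A\otimes A^{\otimes q}\to A^*$ of degree $D$ with $\phi\circ\widehat{m}=(-1)^D\,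 b_{A^*}\circ\widehat\phi$, where $A^*$ carries the dual bimodule structure $b_{A^*}(\vec a,\alpha,\vec b)(w)=-(-1)^{|\alpha|'+|\vec a|'(|\alpha|'+|\vec b|'+|w|')}\,\alpha(m(\vec b,w,\vec a))$. It is a *strong homotopy inner product* if it is * skew-symmetric: $\phi(\vec a,\underline v,\vec b)(w)=-(-1)^{(|\vec a|'+|v|')(|\vec b|'+|w|')}\phi(\vec b,\underline w,\vec a)(v)$; * closed: for every family $a_1,\dots,a_n$ and all $i<j<l$, $(-1)^{K_j}\phi(..,\underline{a_i},..)(a_j)+(-1)^{K_l}\phi(..,\underline{a_j},..)(a_l)+(-1)^{K_i}\phi(..,\underline{a_l},..)(a_i)=0$, where the remaining arguments are placed by the cyclic order of the family and $K_s=(|a_1|'+\dots+|a_s|')(|a_{s+1}|'+\dots+|a_n|')$; * homologically non-degenerate: for every cocycle $a$ with $[a]\ne0$ there is a cocycle $b$ with $\phi_{0,0}(a)(b)\neq0$. A *cyclic inner product* of degree $D$ on an $A_\infty$-algebra $B$ is a non-degenerate bilinear form $\langle\cdot,\cdot\rangle$ on $B$, homogeneous of degree $D$ with respect to shifted degrees,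 with $\langle v,w\rangle=-(-1)^{|v|'|w|'}\langle w,v\rangle$ and $\langle m_n(x_1,\dots,x_n),x_{n+1}\rangle=(-1)^{|x_1|'(|x_2|'+\dots+|x_{n+1}|')}\langle m_n(x_2,\dots,x_{n+1}),x_1\rangle$ for all $n\ge1$; it is identified with the family $\psi:B\to B^*$ with $\psi_{0,0}(v)(w)=\langle v,w\rangle$ and $\psi_{p,q}=0$ for $(p,q)\ne(0,0)$. An $A_\infty$-morphism $f:A\to B$ induces the map $\widetilde f:A\to B$ of bimodules over $A$, $\widetilde f(\vec a,\underline v,\vec b)=f(\vec a,v,\vec b)$, and its dual $\widetilde f^*:B^*\to A^*$, $\widetilde f^*(\vec a,\alpha,\vec b)(w)=(-1)^{|\vec a|'(|\alpha|'+|\vec b|'+|w|')}\alpha(f(\vec b,w,\vec a))$. For a bimodule map $\psi:B\to B^*$ over $B$, considered over $A$ through $f$, one has the composite of bimodule maps $\widetilde f^*\circ\psi\circ\widetilde f:A\to A^*$ over $A$. **Corollary.** Let $A$ be an $A_\infty$-algebra over $k$ and let $\phi:A\to A^*$ be a strong homotopy inner product of degree $D$. Let $H^\bullet(A)$ carry a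 minimal $A_\infty$-algebra structure (that is, one with $m_1=0$) and a cyclic inner product of degree $D$, with corresponding bimodule map $\psi:H^\bullet(A)\to H^\bullet(A)^*$. Suppose that $f:A\to H^\bullet(A)$ is an $A_\infty$-quasi-isomorphism with $$\phi=\widetilde f^{\,*}\circ\psi\circ\widetilde f .$$ Then there is an $A_\infty$-quasi-isomorphism $h:H^\bullet(A)\to A$ with $f\circ h=\mathrm{id}$ as $A_\infty$-morphisms and, for the same $\psi$, $$\psi=\widetilde h^{\,*}\circ\phi\circ\widetilde h .$$ -/

import Mathlib

namespace AInfty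

section Lists

variable {α : Type*}

/-- All ways of writing a list as a concatenation `u ++ v`. -/
def splits : List α → List (List α × List α)
  | [] => [([], [])]
  | x :: xs => ([], x :: xs) :: (splits xs).map fun p => (x :: p.1, p.2)

/-- All ways of writing a list as a concatenation `u ++ v ++ w`. -/
def splits3 (xs : List α) : List (List α × List α × List α) :=
  (splits xs).flatMap fun p => (splits p.2).map fun q => (p.1, q.1, q.2)

/-- All ways of cutting a list into consecutive non-empty blocks. -/
def blockings : List α → List (List (List α))
  | [] => [[]]
  | x :: xs => (blockings xs).flatMap fun P =>
      match P with
      | [] => [[[x]]]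
      | b :: bs => [[x] :: b :: bs, (x :: b) :: bs]

end Lists

section Graded

variable {k : Type*} [Field k]

/-- A `ℤ`-grading `A = ⨁ A^d` of a vector space; `deg d` is the (unshifted) part `A^d`. -/
structure Grading (k : Type*) [Field k] (A : Type*) [AddCommGroup A] [Module k A] where
  deg : ℤ → Submodule k A
  isInternal : DirectSum.IsInternal deg

variable {A : Type*} [AddCommGroup A] [Module k A]

namespace Grading

/-- The elements of shifted degree `d`, that is `(A[1])^d = A^(d+1)`: here `|x|' = |x| - 1 = d`. -/
def sdeg (G : Grading k A) (d : ℤ) : Submodule k A := G.deg (d + 1)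

/-- `G.Homog ds xs`: the entries of the list `xs` are homogeneous, and `ds` is the list of their
shifted degrees. -/
def Homog (G : Grading k A) (ds : List ℤ) (xs : List A) : Prop :=
  List.Forall₂ (fun d x => x ∈ G.sdeg d) ds xs

/-- The decomposition of the elements of `A` into homogeneous components. -/
noncomputable def decomp (G : Grading k A) : A ≃ₗ[k] DirectSum ℤ fun d => G.deg d :=
  (LinearEquiv.ofBijective (DirectSum.coeLinearMap G.deg) G.isInternal).symm

theorem decomp_of_mem (G : Grading k A) {d : ℤ} {x : A} (hx : x ∈ G.deg d) :
    G.decomp x = DirectSum.lof k ℤ (fun d => G.deg d) d ⟨x, hx⟩ :=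
  (LinearEquiv.symm_apply_eq _).2 (DirectSum.coeLinearMap_lof G.deg d ⟨x, hx⟩).symm

/-- The linear map that is multiplication by `(-1)^|x|'` on homogeneous elements `x`.
Koszul signs are written with it: `xs.map G.sign` stands for
`(-1)^(|x₁|' + ⋯ + |xₙ|') x₁ ⊗ ⋯ ⊗ xₙ`. -/
noncomputable def sign (G : Grading k A) : A →ₗ[k] A :=
  (DirectSum.toModule k ℤ A fun d => ((-1 : k) ^ (d - 1)) • (G.deg d).subtype) ∘ₗ
    G.decomp.toLinearMap

theorem sign_of_mem (G : Grading k A) {d : ℤ} {x : A} (hx : x ∈ G.sdeg d) :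
    G.sign x = (-1 : k) ^ d • x := by
  have h := G.decomp_of_mem (d := d + 1) hx
  simp [sign, h, DirectSum.toModule_lof]

end Grading

/-- A family of multilinear maps `F_n : A^{⊗n} → B`, `n ≥ 0`, is encoded as one function on lists,
`F [x₁, …, xₙ] = F_n(x₁, …, xₙ)`, linear in each entry. -/
def IsMultilinear (k : Type*) [Field k] {A B : Type*} [AddCommGroup A] [Module k A]
    [AddCommGroup B] [Module k B] (F : List A → B) : Prop :=
  ∀ u v : List A, IsLinearMap k fun x => F (u ++ x :: v)

/-- An `A_∞`-algebra structure on the graded vector space `A`: operations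
`m_n : A^{⊗n} → A`, `n ≥ 1`, of shifted degree `1` with
`∑ (-1)^(|x₁|' + ⋯ + |x_i|') m(x₁, …, x_i, m(x_{i+1}, …, x_j), x_{j+1}, …, xₙ) = 0`. -/
structure Alg (G : Grading k A) where
  m : List A → A
  multilinear : IsMultilinear k m
  nil : m [] = 0
  degree : ∀ ds xs, G.Homog ds xs → m xs ∈ G.sdeg (ds.sum + 1)
  rel : ∀ xs : List A,
    ((splits3 xs).map fun p => m (p.1.map G.sign ++ m p.2.1 :: p.2.2)).sum = 0

variable {G : Grading k A}

namespace Alg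

/-- The differential `m₁`. -/
def d (𝔸 : Alg G) : A →ₗ[k] A :=
  (𝔸.multilinear [] []).mk' fun x => 𝔸.m [x]

@[simp] theorem d_apply (𝔸 : Alg G) (x : A) : 𝔸.d x = 𝔸.m [x] := rfl

theorem d_d (𝔸 : Alg G) (x : A) : 𝔸.d (𝔸.d x) = 0 := by
  have h := 𝔸.rel [x]
  have h1 : 𝔸.m [0, x] = 0 := (𝔸.multilinear [] [x]).map_zero
  have h2 : 𝔸.m [G.sign x, 0] = 0 := (𝔸.multilinear [G.sign x] []).map_zero
  simpa [splits3, splits, 𝔸.nil, h1, h2] using h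

theorem d_mem (𝔸 : Alg G) {i : ℤ} {x : A} (hx : x ∈ G.deg i) : 𝔸.d x ∈ G.deg (i + 1) := by
  have h := 𝔸.degree [i - 1] [x] (by simpa [Grading.Homog, Grading.sdeg] using hx)
  simpa [Grading.sdeg] using h

/-- The cohomology `H^•(A) = ker m₁ / im m₁`. -/
abbrev Coh (𝔸 : Alg G) : Type _ :=
  LinearMap.ker 𝔸.d ⧸ (LinearMap.range 𝔸.d).comap (LinearMap.ker 𝔸.d).subtype

/-- The class of a cocycle. -/
def toCoh (𝔸 : Alg G) : LinearMap.ker 𝔸.d →ₗ[k] 𝔸.Coh := Submodule.mkQ _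

/-- `H^i(A)`: the classes of the cocycles of degree `i`. -/
def cohDeg (𝔸 : Alg G) (i : ℤ) : Submodule k 𝔸.Coh :=
  ((G.deg i).comap (LinearMap.ker 𝔸.d).subtype).map 𝔸.toCoh

end Alg

/-- The projection of `A` to `A^i`. -/
noncomputable def Grading.proj (G : Grading k A) (i : ℤ) : A →ₗ[k] A :=
  (G.deg i).subtype ∘ₗ DirectSum.component k ℤ (fun d => G.deg d) i ∘ₗ
    G.decomp.toLinearMap

theorem Grading.proj_mem (G : Grading k A) (i : ℤ) (x : A) : G.proj i x ∈ G.deg i := by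
  simp [Grading.proj]

theorem Grading.proj_of_mem (G : Grading k A) {i : ℤ} (j : ℤ) {x : A} (hx : x ∈ G.deg i) :
    G.proj j x = if i = j then x else 0 := by
  have h := G.decomp_of_mem hx
  simp only [Grading.proj, LinearMap.comp_apply, LinearEquiv.coe_coe, h]
  split_ifs with hij
  · subst hij
    simp [DirectSum.component.lof_self]
  · simp [DirectSum.component.of, hij]

theorem Grading.linearMap_ext (G : Grading k A) {B : Type*} [AddCommGroup B] [Module k B]
    {f g : A →ₗ[k] B} (h : ∀ i, ∀ x ∈ G.deg i, f x = g x) : f = g := by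
  have ht : (⊤ : Submodule k A) ≤ LinearMap.eqLocus f g := by
    rw [← G.isInternal.submodule_iSup_eq_top]
    exact iSup_le fun i x hx => h i x hx
  ext x
  exact ht (Submodule.mem_top (x := x))

theorem Alg.d_proj (𝔸 : Alg G) (i : ℤ) (x : A) : 𝔸.d (G.proj i x) = G.proj (i + 1) (𝔸.d x) := by
  have : 𝔸.d ∘ₗ G.proj i = G.proj (i + 1) ∘ₗ 𝔸.d := by
    refine G.linearMap_ext fun j x hx => ?_
    simp only [LinearMap.comp_apply]
    rw [G.proj_of_mem i hx, G.proj_of_mem (i + 1) (𝔸.d_mem hx)]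
    by_cases hij : j = i
    · simp only [hij, if_true]
    · rw [if_neg hij, if_neg (by omega), map_zero]
  exact LinearMap.congr_fun this x

/-- The projection `H^•(A) → H^i(A)`. -/
noncomputable def Alg.cohProj (𝔸 : Alg G) (i : ℤ) : 𝔸.Coh →ₗ[k] 𝔸.Coh :=
  Submodule.mapQ _ _
    ((G.proj i).restrict (p := LinearMap.ker 𝔸.d) (q := LinearMap.ker 𝔸.d) (by
      intro x hx
      rw [LinearMap.mem_ker] at hx ⊢
      rw [𝔸.d_proj, hx, map_zero]))
    (by
      rintro ⟨x, hx⟩ ⟨y, hy⟩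
      refine ⟨G.proj (i - 1) y, ?_⟩
      rw [𝔸.d_proj, hy]
      simp)

theorem Alg.cohProj_of_mem (𝔸 : Alg G) {i : ℤ} (j : ℤ) {x : 𝔸.Coh} (hx : x ∈ 𝔸.cohDeg i) :
    𝔸.cohProj j x = if i = j then x else 0 := by
  obtain ⟨⟨z, hz⟩, hzi, rfl⟩ := hx
  have hzi' : z ∈ G.deg i := hzi
  have h : 𝔸.cohProj j (𝔸.toCoh ⟨z, hz⟩) =
      𝔸.toCoh ((G.proj j).restrict (p := LinearMap.ker 𝔸.d) (q := LinearMap.ker 𝔸.d) (by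
        intro x hx
        rw [LinearMap.mem_ker] at hx ⊢
        rw [𝔸.d_proj, hx, map_zero]) ⟨z, hz⟩) := rfl
  rw [h]
  split_ifs with hij
  · congr 1
    ext
    simp [G.proj_of_mem j hzi', hij]
  · have : (G.proj j).restrict (p := LinearMap.ker 𝔸.d) (q := LinearMap.ker 𝔸.d) (by
        intro x hx
        rw [LinearMap.mem_ker] at hx ⊢
        rw [𝔸.d_proj, hx, map_zero]) ⟨z, hz⟩ = 0 := by
      ext
      simp [G.proj_of_mem j hzi', hij]
    rw [this, map_zero]

theorem Alg.cohDeg_isInternal (𝔸 : Alg G) : DirectSum.IsInternal 𝔸.cohDeg := by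
  classical
  rw [DirectSum.isInternal_submodule_iff_iSupIndep_and_iSup_eq_top]
  constructor
  · intro i
    rw [Submodule.disjoint_def]
    intro x hx hx'
    have h1 : 𝔸.cohProj i x = x := by simp [𝔸.cohProj_of_mem i hx]
    have h2 : (⨆ j, ⨆ (_ : j ≠ i), 𝔸.cohDeg j) ≤ LinearMap.ker (𝔸.cohProj i) :=
      iSup_le fun j => iSup_le fun hj y hy => by
        simp [𝔸.cohProj_of_mem i hy, hj]
    rw [← h1]
    exact h2 hx'
  · rw [eq_top_iff]
    rintro x -
    obtain ⟨⟨z, hz⟩, rfl⟩ := Submodule.mkQ_surjective _ x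
    have hsum : z = ∑ i ∈ (G.decomp z).support, G.proj i z :=
      (G.decomp.symm_apply_apply z).symm.trans
        (DirectSum.coeLinearMap_eq_dfinsuppSum G.deg (G.decomp z))
    have hc : ∀ i, G.proj i z ∈ LinearMap.ker 𝔸.d := fun i => by
      rw [LinearMap.mem_ker] at hz ⊢
      rw [𝔸.d_proj, hz, map_zero]
    have hz' : (⟨z, hz⟩ : LinearMap.ker 𝔸.d) =
        ∑ i ∈ (G.decomp z).support, ⟨G.proj i z, hc i⟩ := by
      ext
      simpa using hsum
    rw [hz', map_sum]
    exact Submodule.sum_mem _ fun i _ => Submodule.mem_iSup_of_mem i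
      ⟨⟨G.proj i z, hc i⟩, G.proj_mem i z, rfl⟩

/-- The grading of the cohomology `H^•(A)`. -/
def Alg.cohGrading (𝔸 : Alg G) : Grading k 𝔸.Coh := ⟨𝔸.cohDeg, 𝔸.cohDeg_isInternal⟩

/-- An `A_∞`-algebra is minimal if `m₁ = 0`. -/
def Alg.IsMinimal (𝔸 : Alg G) : Prop := ∀ x, 𝔸.m [x] = 0

section Morphisms

variable {B : Type*} [AddCommGroup B] [Module k B] {G' : Grading k B}

/-- An `A_∞`-morphism `A → B`: maps `f_n : A^{⊗n} → B`, `n ≥ 1`, of shifted degree `0` with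
`∑ (-1)^(|x₁|' + ⋯ + |x_i|') f(x₁, …, x_i, m(x_{i+1}, …, x_j), x_{j+1}, …, xₙ)
  = ∑ m(f(x₁, …, x_{i₁}), …, f(x_{i_{r-1}+1}, …, xₙ))`. -/
structure Hom (𝔸 : Alg G) (𝔹 : Alg G') where
  f : List A → B
  multilinear : IsMultilinear k f
  nil : f [] = 0
  degree : ∀ ds xs, G.Homog ds xs → f xs ∈ G'.sdeg ds.sum
  rel : ∀ xs : List A,
    ((splits3 xs).map fun p => f (p.1.map G.sign ++ 𝔸.m p.2.1 :: p.2.2)).sum =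
      ((blockings xs).map fun P => 𝔹.m (P.map f)).sum

variable {𝔸 : Alg G} {𝔹 : Alg G'}

/-- The linear part `f₁`. -/
def Hom.linear (f : Hom 𝔸 𝔹) : A →ₗ[k] B :=
  (f.multilinear [] []).mk' fun x => f.f [x]

theorem Hom.linear_d (f : Hom 𝔸 𝔹) (x : A) : f.linear (𝔸.d x) = 𝔹.d (f.linear x) := by
  have h := f.rel [x]
  have h1 : f.f [0, x] = 0 := (f.multilinear [] [x]).map_zero
  have h2 : f.f [G.sign x, 0] = 0 := (f.multilinear [G.sign x] []).map_zero
  change f.f [𝔸.m [x]] = 𝔹.m [f.f [x]]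
  simpa [splits3, splits, blockings, 𝔸.nil, h1, h2] using h

/-- The map `H^•(A) → H^•(B)` induced by `f₁`. -/
def Hom.cohMap (f : Hom 𝔸 𝔹) : 𝔸.Coh →ₗ[k] 𝔹.Coh :=
  Submodule.mapQ _ _
    (f.linear.restrict (p := LinearMap.ker 𝔸.d) (q := LinearMap.ker 𝔹.d) (by
      intro x hx
      rw [LinearMap.mem_ker] at hx ⊢
      rw [← f.linear_d, hx, map_zero]))
    (by
      rintro ⟨x, hx⟩ ⟨y, hy⟩
      refine ⟨f.linear y, ?_⟩
      rw [← f.linear_d, hy]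
      rfl)

/-- `f` is an `A_∞`-quasi-isomorphism: `f₁` induces an isomorphism on cohomology. -/
def Hom.IsQuasiIso (f : Hom 𝔸 𝔹) : Prop := Function.Bijective f.cohMap

/-- Composition of `A_∞`-morphisms, on the families of their components:
`(g ∘ f)(x₁, …, xₙ) = ∑ g(f(x₁, …, x_{i₁}), …, f(x_{i_{r-1}+1}, …, xₙ))`. -/
def compFamily {A B C : Type*} [AddCommGroup C] (g : List B → C) (f : List A → B) : List A → C :=
  fun xs => ((blockings xs).map fun P => g (P.map f)).sum

/-- The components of the identity `A_∞`-morphism: `id₁ = id` and `id_n = 0` for `n ≠ 1`. -/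
def idFamily {A : Type*} [AddCommGroup A] : List A → A
  | [x] => x
  | _ => 0

end Morphisms

section Bimodules

/-- Families `φ_{p,q} : A^{⊗p} ⊗ M ⊗ A^{⊗q} → N`, `p, q ≥ 0`: `φ a b v` stands for
`φ_{p,q}(a₁, …, a_p, v, b₁, …, b_q)`, where `v` is the bimodule element. -/
abbrev BiFamily (k A M N : Type*) [Field k] [AddCommGroup M] [Module k M] [AddCommGroup N]
    [Module k N] : Type _ :=
  List A → List A → M →ₗ[k] N

/-- The data of an `A_∞`-bimodule over `A` on `M`: the part `sdeg d` of shifted degree `d`, the map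
`sign` that is multiplication by `(-1)^d` on it, and the structure maps
`b_{p,q} : A^{⊗p} ⊗ M ⊗ A^{⊗q} → M`. -/
structure BimoduleData (k A M : Type*) [Field k] [AddCommGroup M] [Module k M] where
  sdeg : ℤ → Submodule k M
  sign : M →ₗ[k] M
  b : BiFamily k A M M

/-- `A` as a bimodule over itself: `b_{p,q}(a, v, b) = m(a, v, b)`. -/
noncomputable def Alg.diagonal (𝔸 : Alg G) : BimoduleData k A A where
  sdeg := G.sdeg
  sign := G.sign
  b := fun a b => (𝔸.multilinear a b).mk' fun v => 𝔸.m (a ++ v :: b)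

/-- The dual bimodule `A^*`. A functional has shifted degree `d` if it vanishes on all elements of
shifted degree other than `-d`. The structure maps are
`b_{p,q}(a, α, b)(w) = -(-1)^(|α|' + |a|'(|α|' + |b|' + |w|')) α(m(b, w, a))`.
As the right side vanishes unless `|α|' = -(|a|' + |b|' + |w|' + 1)`, this sign is
`-(-1)^|α|' = -(-1)^|m(b, w, a)|'`. -/
noncomputable def Alg.dual (𝔸 : Alg G) : BimoduleData k A (Module.Dual k A) where
  sdeg := fun d => ⨅ e : {e : ℤ // e ≠ -d}, (G.sdeg e).dualAnnihilator
  sign := G.sign.dualMap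
  b := fun a b => -((G.sign ∘ₗ 𝔸.diagonal.b b a).dualMap)

/-- `φ : M → N` is a map of `A_∞`-bimodules over `A` of shifted degree `D`:
`φ ∘ b̂_M = (-1)^D b_N ∘ φ̂`, with Koszul signs. -/
structure IsBimoduleMap {M N : Type*} [AddCommGroup M] [Module k M] [AddCommGroup N] [Module k N]
    (𝔸 : Alg G) (D : ℤ) (𝔐 : BimoduleData k A M) (𝔑 : BimoduleData k A N)
    (φ : BiFamily k A M N) : Prop where
  multilinear_left : ∀ b, IsMultilinear k fun a => φ a b
  multilinear_right : ∀ a, IsMultilinear k fun b => φ a b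
  degree : ∀ ds a es b i v, G.Homog ds a → G.Homog es b → v ∈ 𝔐.sdeg i →
    φ a b v ∈ 𝔑.sdeg (ds.sum + i + es.sum + D)
  rel : ∀ (a b : List A) (v : M),
    ((splits3 a).map fun p => φ (p.1.map G.sign ++ 𝔸.m p.2.1 :: p.2.2) b v).sum
    + ((splits a).map fun p => ((splits b).map fun q =>
        φ (p.1.map G.sign) q.2 (𝔐.b p.2 q.1 v)).sum).sum
    + ((splits3 b).map fun q =>
        φ (a.map G.sign) (q.1.map G.sign ++ 𝔸.m q.2.1 :: q.2.2) (𝔐.sign v)).sum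
    = (-1 : k) ^ D • ((splits a).map fun p => ((splits b).map fun q =>
        𝔑.b (p.1.map (G.sign ^ D.natAbs : Module.End k A)) q.2 (φ p.2 q.1 v)).sum).sum

/-- Composition of bimodule maps over `A`, where the inner map `φ` has shifted degree `D`:
`(ψ ∘ φ)(a, v, b) = ∑ (-1)^(D |a'|') ψ(a', φ(a'', v, b'), b'')` over `a = a' a''`, `b = b' b''`. -/
noncomputable def BiFamily.comp {M N P : Type*} [AddCommGroup M] [Module k M] [AddCommGroup N]
    [Module k N] [AddCommGroup P] [Module k P] (G : Grading k A) (ψ : BiFamily k A N P) (D : ℤ)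
    (φ : BiFamily k A M N) : BiFamily k A M P :=
  fun a b => ((splits a).map fun p => ((splits b).map fun q =>
    ψ (p.1.map (G.sign ^ D.natAbs : Module.End k A)) q.2 ∘ₗ φ p.2 q.1).sum).sum

/-- The dual `g^* : N^* → M^*` of a bimodule map `g : M → N` of shifted degree `0`:
`g^*(a, α, b)(w) = (-1)^(|a|'(|α|' + |b|' + |w|')) α(g(b, w, a))`.
As the right side vanishes unless `|α|' + |b|' + |w|' + |a|' = 0`, this sign is `(-1)^|a|'`. -/
noncomputable def BiFamily.dual {M N : Type*} [AddCommGroup M] [Module k M] [AddCommGroup N]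
    [Module k N] (G : Grading k A) (g : BiFamily k A M N) :
    BiFamily k A (Module.Dual k N) (Module.Dual k M) :=
  fun a b => (g b (a.map G.sign)).dualMap

variable {B : Type*} [AddCommGroup B] [Module k B] {G' : Grading k B}
  {𝔸 : Alg G} {𝔹 : Alg G'}

/-- The bimodule map `f̃ : A → B` over `A` induced by an `A_∞`-morphism `f : A → B`, where `B` is a
bimodule over `A` through `f`: `f̃(a, v, b) = f(a, v, b)`. -/
def Hom.tilde (f : Hom 𝔸 𝔹) : BiFamily k A A B :=
  fun a b => (f.multilinear a b).mk' fun v => f.f (a ++ v :: b)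

/-- A bimodule map over `B`, viewed through `f : A → B` as a bimodule map over `A`:
`(a, v, b) ↦ ψ(f̂(a), v, f̂(b))`. -/
def Hom.restrict (f : Hom 𝔸 𝔹) {M N : Type*} [AddCommGroup M] [Module k M] [AddCommGroup N]
    [Module k N] (ψ : BiFamily k B M N) : BiFamily k A M N :=
  fun a b => ((blockings a).map fun P => ((blockings b).map fun Q =>
    ψ (P.map f.f) (Q.map f.f)).sum).sum

/-- The composite `f̃^* ∘ ψ ∘ f̃ : A → B → B^* → A^*` of bimodule maps over `A`, for a bimodule map
`ψ : B → B^*` over `B` of shifted degree `D`. -/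
noncomputable def Hom.pullback (f : Hom 𝔸 𝔹) (D : ℤ) (ψ : BiFamily k B B (Module.Dual k B)) :
    BiFamily k A A (Module.Dual k A) :=
  BiFamily.comp G (BiFamily.dual G f.tilde) D (BiFamily.comp G (f.restrict ψ) 0 f.tilde)

end Bimodules

section InnerProducts

/-- A strong homotopy inner product of shifted degree `D` on an `A_∞`-algebra `A`: a bimodule map
`φ : A → A^*` that is skew-symmetric, closed and homologically non-degenerate. -/
structure IsStrongHomotopyInnerProduct (𝔸 : Alg G) (D : ℤ)
    (φ : BiFamily k A A (Module.Dual k A)) : Prop where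
  bimoduleMap : IsBimoduleMap 𝔸 D 𝔸.diagonal 𝔸.dual φ
  skew : ∀ (ds es : List ℤ) (i j : ℤ) (a b : List A) (v w : A),
    G.Homog ds a → G.Homog es b → v ∈ G.sdeg i → w ∈ G.sdeg j →
    φ a b v w = -(-1 : k) ^ ((ds.sum + i) * (es.sum + j)) * φ b a w v
  /-- The family is `p, x, q, y, r, z, s` (with `x = a_i`, `y = a_j`, `z = a_k`). Each term carries
  the Koszul sign of the rotation of the family that moves the argument of the functional to the
  last place. -/
  closed : ∀ (dp dq dr ds : List ℤ) (i j l : ℤ) (p q r s : List A) (x y z : A),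
    G.Homog dp p → G.Homog dq q → G.Homog dr r → G.Homog ds s →
    x ∈ G.sdeg i → y ∈ G.sdeg j → z ∈ G.sdeg l →
    (-1 : k) ^ ((dp.sum + i + dq.sum + j) * (dr.sum + l + ds.sum))
        * φ (r ++ z :: (s ++ p)) q x y
      + (-1 : k) ^ ((dp.sum + i + dq.sum + j + dr.sum + l) * ds.sum)
        * φ (s ++ p ++ x :: q) r y z
      + (-1 : k) ^ ((dp.sum + i) * (dq.sum + j + dr.sum + l + ds.sum))
        * φ (q ++ y :: r) (s ++ p) z x = 0
  nondegenerate : ∀ v : LinearMap.ker 𝔸.d, 𝔸.toCoh v ≠ 0 →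
    ∃ w : LinearMap.ker 𝔸.d, φ [] [] (v : A) (w : A) ≠ 0

/-- A cyclic inner product of shifted degree `D` on an `A_∞`-algebra `A`: a non-degenerate bilinear
form with `⟨v, w⟩ = -(-1)^(|v|'|w|') ⟨w, v⟩` and
`⟨m(x₁, …, xₙ), x_{n+1}⟩ = (-1)^(|x₁|'(|x₂|' + ⋯ + |x_{n+1}|')) ⟨m(x₂, …, x_{n+1}), x₁⟩`. -/
structure IsCyclicInnerProduct (𝔸 : Alg G) (D : ℤ) (ω : A →ₗ[k] Module.Dual k A) : Prop where
  degree : ∀ i j v w, v ∈ G.sdeg i → w ∈ G.sdeg j → i + j + D ≠ 0 → ω v w = 0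
  skew : ∀ i j v w, v ∈ G.sdeg i → w ∈ G.sdeg j → ω v w = -(-1 : k) ^ (i * j) * ω w v
  nondegenerate : LinearMap.BilinForm.Nondegenerate ω
  cyclic : ∀ i ds j x xs y, x ∈ G.sdeg i → G.Homog ds xs → y ∈ G.sdeg j →
    ω (𝔸.m (x :: xs)) y = (-1 : k) ^ (i * (ds.sum + j)) * ω (𝔸.m (xs ++ [y])) x

/-- The bimodule map `ψ : A → A^*` of a cyclic inner product: `ψ_{0,0}(v)(w) = ⟨v, w⟩`, and
`ψ_{p,q} = 0` for `(p, q) ≠ (0, 0)`. -/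
def cyclicFamily (ω : A →ₗ[k] Module.Dual k A) : BiFamily k A A (Module.Dual k A)
  | [], [] => ω
  | _, _ => 0

end InnerProducts

end Graded

end AInfty

/-! Pullback along `A_∞`-morphisms is contravariantly functorial, signs included. Hence any `h` with
`f ∘ h = id` pulls `φ`, the pullback of `ψ` along `f`, back to the pullback of `ψ` along the
identity, which is `ψ` itself (`Hom.pullback_pullback`, `Hom.pullback_eq_cyclicFamily`). On
cohomology `f` is bijective, so its right inverse `h` is bijective too. What remains is to find a
strict right inverse, `Hom.IsQuasiIso.exists_rightInverse`.

It is built by recursion on the number `n` of inputs. Since the target is minimal, `f₁` maps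
cocycles onto it, and `ker f₁` is acyclic. Choose a graded section `ι` of `f₁` by cocycles, and a
graded `s` with values in `ker f₁` and `d s = id` on `ker d ∩ ker f₁`. Put `h_n = ι(id_n - (f ∘
h_{<n})_n) + s(e)`, where `e` is the amount by which `h_{<n}` violates the morphism relation in `n`
inputs. The first summand forces `(f ∘ h)_n = id_n`; the second gives `d h_n = e`, which is the
relation, once `e` is known to lie in `ker d ∩ ker f₁`. That is the obstruction computation:
`compFamily_insFamily_of_forall_lt`, applied to `F = f` and to `F = m`.

In bar-construction terms `insFamily` is `F ∘ m̂` and `compFamily` is `F ∘ ĥ`. Coalgebra identities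
for `m̂` and `ĥ` are proved by peeling off the first entry or block of a list. -/

namespace AInfty

set_option linter.unusedSectionVars false

/-! ### Deconcatenation of lists and sums over cuts. -/

section SplitSum

variable {α M N : Type*} [AddCommMonoid M] [AddCommMonoid N]

/-- The sum of `Φ u v` over all `u ++ v = xs`. -/
def splitSum (Φ : List α → List α → M) (xs : List α) : M :=
  ((splits xs).map fun p => Φ p.1 p.2).sum

@[simp] theorem splitSum_nil (Φ : List α → List α → M) : splitSum Φ [] = Φ [] [] := by
  simp [splitSum, splits]

theorem splitSum_cons (Φ : List α → List α → M) (x : α) (xs : List α) :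
    splitSum Φ (x :: xs) = Φ [] (x :: xs) + splitSum (fun u v => Φ (x :: u) v) xs := by
  simp [splitSum, splits, Function.comp_def]

theorem splitSum_congr {Φ Ψ : List α → List α → M} {xs : List α}
    (h : ∀ u v, u ++ v = xs → Φ u v = Ψ u v) : splitSum Φ xs = splitSum Ψ xs := by
  induction xs generalizing Φ Ψ with
  | nil => simpa using h [] [] rfl
  | cons x xs ih =>
    rw [splitSum_cons, splitSum_cons, h [] _ rfl, ih fun u v huv => h (x :: u) v (by simp [huv])]

theorem splitSum_add (Φ Ψ : List α → List α → M) (xs : List α) :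
    splitSum (fun u v => Φ u v + Ψ u v) xs = splitSum Φ xs + splitSum Ψ xs := by
  induction xs generalizing Φ Ψ with
  | nil => simp
  | cons x xs ih => simp only [splitSum_cons, ih]; abel

theorem splitSum_zero (xs : List α) : splitSum (fun _ _ => (0 : M)) xs = 0 := by
  induction xs with
  | nil => simp
  | cons x xs ih => simp [splitSum_cons, ih]

theorem splitSum_eq_zero {Φ : List α → List α → M} {xs : List α}
    (h : ∀ u v, u ++ v = xs → Φ u v = 0) : splitSum Φ xs = 0 :=
  (splitSum_congr h).trans (splitSum_zero xs)

/-- Coassociativity of deconcatenation: both sides run over all cuts into three pieces. -/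
theorem splitSum_assoc (Φ : List α → List α → List α → M) (xs : List α) :
    splitSum (fun u v => splitSum (fun v₁ v₂ => Φ u v₁ v₂) v) xs =
      splitSum (fun w v₂ => splitSum (fun u v₁ => Φ u v₁ v₂) w) xs := by
  induction xs generalizing Φ with
  | nil => simp
  | cons x xs ih =>
    simp only [splitSum_cons, splitSum_nil, splitSum_add, ih, add_assoc]

theorem splitSum_comm {β : Type*} (Φ : List α → List α → List β → List β → M) (xs : List α)
    (ys : List β) :
    splitSum (fun u v => splitSum (fun p q => Φ u v p q) ys) xs =
      splitSum (fun p q => splitSum (fun u v => Φ u v p q) xs) ys := by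
  induction xs generalizing Φ with
  | nil => simp
  | cons x xs ih => simp only [splitSum_cons, splitSum_add, ih]

theorem splitSum_append_cons (Φ : List α → List α → M) (a b : List α) (x : α) :
    splitSum Φ (a ++ x :: b) = splitSum (fun u v => Φ u (v ++ x :: b)) a +
      splitSum (fun u v => Φ (a ++ x :: u) v) b := by
  induction a generalizing Φ with
  | nil => simp [splitSum_cons]
  | cons y a ih => simp [splitSum_cons, ih, add_assoc]

theorem splitSum_map {β : Type*} (g : β → α) (Φ : List α → List α → M) (xs : List β) :
    splitSum Φ (xs.map g) = splitSum (fun u v => Φ (u.map g) (v.map g)) xs := by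
  induction xs generalizing Φ with
  | nil => simp
  | cons y a ih => simp [splitSum_cons, ih]

theorem splitSum_eq_full {Φ : List α → List α → M} {xs : List α}
    (h : ∀ u v, u ++ v = xs → u.length < xs.length → Φ u v = 0) :
    splitSum Φ xs = Φ xs [] := by
  induction xs generalizing Φ with
  | nil => simp
  | cons x xs ih =>
    rw [splitSum_cons, h [] _ rfl (by simp), zero_add]
    exact ih fun u v huv hl => h (x :: u) v (by simp [huv]) (by simpa using hl)

theorem splitSum_eq_empty {Φ : List α → List α → M} {xs : List α}
    (h : ∀ u v, u ++ v = xs → u ≠ [] → Φ u v = 0) :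
    splitSum Φ xs = Φ [] xs := by
  cases xs with
  | nil => simp
  | cons x xs =>
    rw [splitSum_cons, splitSum_eq_zero fun u v huv => h (x :: u) v (by simp [huv]) (by simp),
      add_zero]

theorem splitSum_mem {R : Type*} [Semiring R] [Module R M] {K : Submodule R M}
    {Φ : List α → List α → M} {xs : List α}
    (h : ∀ u v, u ++ v = xs → Φ u v ∈ K) : splitSum Φ xs ∈ K := by
  induction xs generalizing Φ with
  | nil => simpa using h [] [] rfl
  | cons x xs ih =>
    rw [splitSum_cons]
    exact K.add_mem (h [] _ rfl) (ih fun u v huv => h (x :: u) v (by simp [huv]))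

/-- `blockings` recurses by opening a new block or enlarging the first one. Sorting by the whole
first block instead gives the recursion on which every later induction over `compFamily` rests. -/
theorem sum_map_blockings_cons (Φ : List (List α) → M) (x : α) (xs : List α) :
    ((blockings (x :: xs)).map Φ).sum =
      splitSum (fun u v => ((blockings v).map fun Q => Φ ((x :: u) :: Q)).sum) xs := by
  have hflat : ∀ (L : List (List (List α))) (t : List (List α) → List (List (List α))),
      ((L.flatMap t).map Φ).sum = (L.map fun P => ((t P).map Φ).sum).sum := by
    intro L t
    induction L with
    | nil => simp
    | cons P L ih => simp [ih]
  induction xs generalizing x Φ with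
  | nil => simp [blockings]
  | cons y ys ih =>
    rw [blockings, hflat, ih, splitSum_cons, ih, ← splitSum_add]
    · refine splitSum_congr fun u v _ => ?_
      simp [← List.sum_map_add]
    all_goals
      intro L t
      induction L with
      | nil => simp
      | cons P L ih => simp [ih]

end SplitSum

/-! ### Coderivations and coalgebra morphisms, through their components. -/

section Families

variable {k : Type*} [Field k] {A B C M N : Type*} [AddCommGroup A] [Module k A]
  [AddCommGroup B] [Module k B] [AddCommGroup C] [Module k C] [AddCommGroup M] [Module k M]
  [AddCommGroup N] [Module k N]

/-- `F ∘ m̂`, where `m̂` is the coderivation with components `m`, and `σ` gives the Koszul sign. -/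
def insFamily (σ : A → A) (F : List A → M) (m : List A → A) : List A → M :=
  fun xs => ((splits3 xs).map fun p => F (p.1.map σ ++ m p.2.1 :: p.2.2)).sum

theorem insFamily_eq_splitSum (σ : A → A) (F : List A → M) (m : List A → A) (xs : List A) :
    insFamily σ F m xs =
      splitSum (fun u v => splitSum (fun p q => F (u.map σ ++ m p :: q)) v) xs := by
  have hflat : ∀ L : List (List A × List A),
      ((L.flatMap fun p => (splits p.2).map fun q => (p.1, q.1, q.2)).map
        fun p => F (p.1.map σ ++ m p.2.1 :: p.2.2)).sum =
      (L.map fun p => splitSum (fun u v => F (p.1.map σ ++ m u :: v)) p.2).sum := by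
    intro L
    induction L with
    | nil => simp
    | cons P L ih => rw [List.flatMap_cons, List.map_append, List.sum_append, ih]
                     simp [splitSum, Function.comp_def]
  exact hflat _

@[simp] theorem insFamily_nil (σ : A → A) (F : List A → M) (m : List A → A) :
    insFamily σ F m [] = F [m []] := by
  simp [insFamily_eq_splitSum]

/-- The inserted operation either starts at the very beginning, or passes `x` and picks up its
Koszul sign. -/
theorem insFamily_cons (σ : A → A) (F : List A → M) (m : List A → A) (x : A) (xs : List A) :
    insFamily σ F m (x :: xs) = splitSum (fun p q => F (m p :: q)) (x :: xs) +
      insFamily σ (fun l => F (σ x :: l)) m xs := by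
  simp [insFamily_eq_splitSum, splitSum_cons]

@[simp] theorem compFamily_nil (F : List B → M) (h : List A → B) : compFamily F h [] = F [] := by
  simp [compFamily, blockings]

theorem compFamily_cons (F : List B → M) (h : List A → B) (x : A) (xs : List A) :
    compFamily F h (x :: xs) =
      splitSum (fun u v => compFamily (fun l => F (h (x :: u) :: l)) h v) xs := by
  simp only [compFamily]
  rw [sum_map_blockings_cons]
  simp

theorem compFamily_add (F F' : List B → M) (h : List A → B) (xs : List A) :
    compFamily (fun l => F l + F' l) h xs = compFamily F h xs + compFamily F' h xs := by
  simp [compFamily, List.sum_map_add]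

theorem compFamily_zero (h : List A → B) (xs : List A) :
    compFamily (fun _ => (0 : M)) h xs = 0 := by
  simp [compFamily]

theorem insFamily_add (σ : A → A) (F F' : List A → M) (m : List A → A) (xs : List A) :
    insFamily σ (fun l => F l + F' l) m xs = insFamily σ F m xs + insFamily σ F' m xs := by
  simp [insFamily, List.sum_map_add]

theorem insFamily_zero (σ : A → A) (m : List A → A) (xs : List A) :
    insFamily σ (fun _ => (0 : M)) m xs = 0 := by
  simp [insFamily]

theorem isLinearMap_sum_map {ι : Type*} (l : List ι) {g : A → ι → M}
    (hg : ∀ i, IsLinearMap k fun y => g y i) : IsLinearMap k fun y => (l.map (g y)).sum := by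
  induction l with
  | nil => exact ⟨by simp, by simp⟩
  | cons i l ih =>
    constructor
    · intro x y; simp only [List.map_cons, List.sum_cons, (hg i).map_add, ih.map_add]; abel
    · intro c x; simp only [List.map_cons, List.sum_cons, (hg i).map_smul, ih.map_smul, smul_add]

theorem isLinearMap_splitSum {α : Type*} {Φ : A → List α → List α → M}
    (h : ∀ u v, IsLinearMap k fun y => Φ y u v) (xs : List α) :
    IsLinearMap k fun y => splitSum (Φ y) xs :=
  isLinearMap_sum_map (splits xs) fun p => h p.1 p.2

theorem isLinearMap_compFamily {F : A → List C → M} (hF : ∀ l, IsLinearMap k fun y => F y l)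
    (h : List B → C) (xs : List B) : IsLinearMap k fun y => compFamily (F y) h xs :=
  isLinearMap_sum_map (blockings xs) fun P => hF (P.map h)

theorem isLinearMap_insFamily {F : A → List B → M} (hF : ∀ l, IsLinearMap k fun y => F y l)
    (σ : B → B) (m : List B → B) (xs : List B) : IsLinearMap k fun y => insFamily σ (F y) m xs :=
  isLinearMap_sum_map (splits3 xs) fun p => hF (p.1.map σ ++ m p.2.1 :: p.2.2)

theorem isLinearMap_add {F F' : A → M} (hF : IsLinearMap k F) (hF' : IsLinearMap k F') :
    IsLinearMap k fun y => F y + F' y :=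
  (hF.mk' F + hF'.mk' F').isLinear

theorem isLinearMap_comp {F : A → M} {g : M → N} (hg : IsLinearMap k g) (hF : IsLinearMap k F) :
    IsLinearMap k fun y => g (F y) :=
  (hg.mk' g ∘ₗ hF.mk' F).isLinear

theorem IsLinearMap.map_sum_map {ι : Type*} {L : M → N} (hL : IsLinearMap k L) (l : List ι)
    (g : ι → M) : L (l.map g).sum = (l.map fun i => L (g i)).sum := by
  induction l with
  | nil => simpa using hL.map_zero
  | cons i l ih => simp [hL.map_add, ih]

theorem IsLinearMap.map_splitSum {α : Type*} {L : M → N} (hL : IsLinearMap k L)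
    (Φ : List α → List α → M) (xs : List α) :
    L (splitSum Φ xs) = splitSum (fun u v => L (Φ u v)) xs :=
  IsLinearMap.map_sum_map hL _ _

theorem IsLinearMap.map_compFamily {L : M → N} (hL : IsLinearMap k L) (F : List B → M)
    (h : List A → B) (xs : List A) :
    L (compFamily F h xs) = compFamily (fun l => L (F l)) h xs :=
  IsLinearMap.map_sum_map hL _ _

theorem IsLinearMap.map_insFamily {L : M → N} (hL : IsLinearMap k L) (σ : A → A) (F : List A → M)
    (m : List A → A) (xs : List A) :
    L (insFamily σ F m xs) = insFamily σ (fun l => L (F l)) m xs :=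
  IsLinearMap.map_sum_map hL _ _

namespace IsMultilinear

variable {F : List A → M}

theorem head (hF : IsMultilinear k F) (l : List A) : IsLinearMap k fun y => F (y :: l) :=
  hF [] l

theorem append_right (hF : IsMultilinear k F) (u : List A) : IsMultilinear k fun l => F (l ++ u) :=
  fun p q => by simpa using hF p (q ++ u)

theorem cons (hF : IsMultilinear k F) (y : A) : IsMultilinear k fun l => F (y :: l) :=
  fun p q => hF (y :: p) q

theorem map_zero_entry (hF : IsMultilinear k F) (u v : List A) : F (u ++ 0 :: v) = 0 :=
  (hF u v).map_zero

end IsMultilinear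

/-- `ĥ` is a morphism of coalgebras: cutting a sequence of blocks amounts to cutting the underlying
list and blocking both parts. -/
theorem compFamily_splitSum (Φ : List B → List B → M) (h : List A → B) (xs : List A) :
    compFamily (splitSum Φ) h xs =
      splitSum (fun u v => compFamily (fun p => compFamily (fun q => Φ p q) h v) h u) xs := by
  induction hn : xs.length using Nat.strong_induction_on generalizing xs Φ with
  | _ n ih =>
    cases xs with
    | nil => simp
    | cons x xs =>
      rw [compFamily_cons, splitSum_cons, compFamily_nil, compFamily_cons]
      simp only [splitSum_cons, compFamily_add, splitSum_add, compFamily_cons]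
      congr 1
      rw [← splitSum_assoc]
      refine splitSum_congr fun u v huv => ?_
      exact ih v.length (by subst huv hn; simp) _ v rfl

/-- The co-Leibniz rule for `m̂`: the inserted entry falls on one side of the cut, and on the right
side it has passed all of `u`. -/
theorem insFamily_splitSum (σ : A → A) (Φ : List A → List A → M) (m : List A → A) (xs : List A) :
    insFamily σ (splitSum Φ) m xs =
      splitSum (fun u v => insFamily σ (fun p => Φ p v) m u +
        insFamily σ (fun q => Φ (u.map σ) q) m v) xs := by
  induction xs generalizing Φ with
  | nil => simp [splitSum_cons, add_comm]
  | cons x xs ih =>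
    rw [insFamily_cons]
    simp only [splitSum_cons _ (m _), splitSum_cons _ (σ x), insFamily_add, splitSum_add, ih]
    rw [splitSum_assoc, splitSum_cons _ x xs]
    simp only [splitSum_cons (fun u v => insFamily σ _ _ _) x xs, insFamily_cons, splitSum_add,
      splitSum_nil, insFamily_nil, List.map_nil, List.map_cons, splitSum_cons _ x]
    abel

theorem insFamily_cons_of_nil {F : List A → M} (hF : IsMultilinear k F) (σ : A → A)
    {m : List A → A} (hm : m [] = 0) (x : A) (xs : List A) :
    insFamily σ F m (x :: xs) = splitSum (fun p q => F (m (x :: p) :: q)) xs +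
      insFamily σ (fun l => F (σ x :: l)) m xs := by
  rw [insFamily_cons, splitSum_cons, hm, (hF.head _).map_zero, zero_add]

end Families

/-! ### Composition, multilinearity and the square of a coderivation. -/

section Coalgebra

variable {k : Type*} [Field k] {A B C M N : Type*} [AddCommGroup A] [Module k A]
  [AddCommGroup B] [Module k B] [AddCommGroup C] [Module k C] [AddCommGroup M] [Module k M]
  [AddCommGroup N] [Module k N]

theorem compFamily_congr {F F' : List B → M} {h h' : List A → B} {xs : List A}
    (hh : ∀ u, u.length ≤ xs.length → h u = h' u) (hF : ∀ l, l.length ≤ xs.length → F l = F' l) :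
    compFamily F h xs = compFamily F' h' xs := by
  induction hn : xs.length using Nat.strong_induction_on generalizing xs F F' with
  | _ n ih =>
    cases xs with
    | nil => simpa using hF [] (by simp)
    | cons x xs =>
      rw [compFamily_cons, compFamily_cons]
      refine splitSum_congr fun u v huv => ?_
      have hl : u.length + v.length = xs.length := by simp [← huv]
      simp only [List.length_cons] at hn hh hF
      rw [hh (x :: u) (by simp; omega)]
      exact ih v.length (by omega) (fun u hu => hh u (by omega))
        (fun l hl => hF _ (by simp; omega)) rfl

/-- Associativity of composition: after peeling off the first block, compatibility of `ĥ` with cuts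
separates what enters the first `g` from the rest. -/
theorem compFamily_comp {F : List C → M} (hF : IsMultilinear k F) (g : List B → C)
    (h : List A → B) (xs : List A) :
    compFamily (compFamily F g) h xs = compFamily F (compFamily g h) xs := by
  induction hn : xs.length using Nat.strong_induction_on generalizing xs F with
  | _ n ih =>
    cases xs with
    | nil => simp
    | cons x xs =>
      simp only [compFamily_cons]
      have e : ∀ u v, compFamily (fun l => splitSum (fun u_1 v =>
          compFamily (fun l => F (g (h (x :: u) :: u_1) :: l)) g v) l) h v = splitSum (fun v₁ v₂ =>
          compFamily (fun p => compFamily (fun q =>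
            compFamily (fun l => F (g (h (x :: u) :: p) :: l)) g q) h v₂) h v₁) v :=
        fun u v => compFamily_splitSum _ _ _
      simp only [e]
      rw [splitSum_assoc]
      refine splitSum_congr fun w v huv => ?_
      have hlin : IsLinearMap k fun y => compFamily (fun l => F (y :: l)) (compFamily g h) v :=
        isLinearMap_compFamily (fun l => hF.head l) _ _
      rw [IsLinearMap.map_splitSum hlin]
      refine splitSum_congr fun u v₁ _ => ?_
      rw [IsLinearMap.map_compFamily hlin]
      congr 1
      funext p
      exact ih v.length (by subst huv hn; simp) (hF.cons _) v rfl

/-- Blockings are sorted by the block containing the marked entry `x`. This isolates the dependence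
on one entry, for multilinearity and later for the bimodule slot. -/
theorem compFamily_append_cons (F : List B → M) (h : List A → B) (a b : List A) (x : A) :
    compFamily F h (a ++ x :: b) = splitSum (fun a₁ a₂ => splitSum (fun b₁ b₂ =>
      compFamily (fun P => compFamily (fun Q => F (P ++ h (a₂ ++ x :: b₁) :: Q)) h b₂) h a₁) b)
      a := by
  induction hn : a.length using Nat.strong_induction_on generalizing a F with
  | _ n ih =>
    cases a with
    | nil => simp [compFamily_cons]
    | cons y a =>
      rw [List.cons_append, compFamily_cons, splitSum_append_cons, splitSum_cons, add_comm]
      congr 1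
      · simp
      · simp only [compFamily_cons]
        simp only [splitSum_comm _ b]
        rw [← splitSum_assoc]
        refine splitSum_congr fun u v huv => ?_
        rw [ih v.length (by subst huv hn; simp) _ v rfl]
        simp

theorem insFamily_append_cons {F : List A → M} (hF : IsMultilinear k F) (σ : A → A)
    {m : List A → A} (hm : m [] = 0) (a b : List A) (x : A) :
    insFamily σ F m (a ++ x :: b) =
      insFamily σ (fun l => F (l ++ x :: b)) m a +
      splitSum (fun a₁ a₂ => splitSum (fun b₁ b₂ =>
        F (a₁.map σ ++ m (a₂ ++ x :: b₁) :: b₂)) b) a +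
      insFamily σ (fun l => F (a.map σ ++ σ x :: l)) m b := by
  induction a generalizing F with
  | nil =>
    have h0 : F (m [] :: x :: b) = 0 := by rw [hm]; exact (hF.head _).map_zero
    simp [insFamily_cons_of_nil hF σ hm, h0]
  | cons y a ih =>
    rw [List.cons_append, insFamily_cons_of_nil hF σ hm, ih (hF.cons _), splitSum_append_cons,
      insFamily_cons_of_nil (hF.append_right _) σ hm, splitSum_cons]
    simp only [List.map_nil, List.nil_append, List.map_cons, List.cons_append]
    abel

theorem IsMultilinear.compFamily {F : List B → M} (hF : IsMultilinear k F) {h : List A → B}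
    (hh : IsMultilinear k h) : IsMultilinear k (compFamily F h) := by
  intro u v
  simp only [compFamily_append_cons]
  exact isLinearMap_splitSum (fun _ _ => isLinearMap_splitSum (fun _ _ =>
    isLinearMap_compFamily (fun _ => isLinearMap_compFamily (fun _ =>
      isLinearMap_comp (hF _ _) (hh _ _)) _ _) _ _) _) _

theorem IsMultilinear.insFamily {F : List A → M} (hF : IsMultilinear k F) (σ : A →ₗ[k] A)
    {m : List A → A} (hm : IsMultilinear k m) (hm₀ : m [] = 0) :
    IsMultilinear k (insFamily σ F m) := by
  intro u v
  simp only [insFamily_append_cons hF σ hm₀]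
  refine isLinearMap_add (isLinearMap_add ?_ ?_) ?_
  · exact isLinearMap_insFamily (fun l => hF l v) _ _ _
  · exact isLinearMap_splitSum (fun _ _ => isLinearMap_splitSum (fun _ _ =>
      isLinearMap_comp (hF _ _) (hm _ _)) _) _
  · exact isLinearMap_insFamily (fun l => isLinearMap_comp (hF _ _) σ.isLinear) _ _ _

/-- `m̂ ∘ m̂ = 0`, from the corresponding identity for the components. -/
theorem insFamily_insFamily {F : List A → M} (hF : IsMultilinear k F) {σ : A →ₗ[k] A}
    (hσ : ∀ x, σ (σ x) = x) {m : List A → A} (hm : IsMultilinear k m) (hm₀ : m [] = 0)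
    (hmσ : ∀ xs, m (xs.map σ) = -σ (m xs)) (hmm : ∀ xs, insFamily σ m m xs = 0) (xs : List A) :
    insFamily σ (insFamily σ F m) m xs = 0 := by
  induction xs generalizing F with
  | nil =>
    rw [insFamily_nil, hm₀]
    exact (hF.insFamily σ hm hm₀).map_zero_entry [] []
  | cons x xs ih =>
    rw [insFamily_cons_of_nil (hF.insFamily σ hm hm₀) σ hm₀]
    simp only [insFamily_cons_of_nil hF σ hm₀, splitSum_add, insFamily_add, hσ]
    rw [ih (hF.cons _), add_zero]
    have e : insFamily σ (fun l => splitSum (fun p q => F (m (σ x :: p) :: q)) l) m xs =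
        splitSum (fun p q => insFamily σ (fun p => F (m (σ x :: p) :: q)) m p +
          insFamily σ (fun q => F (m (σ x :: p.map σ) :: q)) m q) xs :=
      insFamily_splitSum _ _ _ _
    rw [e, splitSum_assoc, splitSum_add]
    -- Nested insertions inside a block starting at `x`: they assemble to `m ∘ m̂` on that block,
    -- which vanishes.
    have e₁ : splitSum (fun w q => splitSum (fun u v => F (m (m (x :: u) :: v) :: q)) w) xs +
        splitSum (fun w q => insFamily σ (fun p => F (m (σ x :: p) :: q)) m w) xs = 0 := by
      rw [← splitSum_add]
      refine splitSum_eq_zero fun w q _ => ?_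
      have hl := hF.head q
      rw [← IsLinearMap.map_splitSum (L := fun y => F (y :: q)) hl,
        ← IsLinearMap.map_insFamily (L := fun y => F (y :: q)) hl, ← hl.map_add,
        ← insFamily_cons_of_nil hm σ hm₀, hmm, hl.map_zero]
    -- Disjoint insertions, taken in the two possible orders, cancel because `m` is odd.
    have e₂ : splitSum (fun p q => insFamily σ (fun l => F (σ (m (x :: p)) :: l)) m q) xs +
        splitSum (fun p q => insFamily σ (fun q => F (m (σ x :: p.map σ) :: q)) m q) xs = 0 := by
      rw [← splitSum_add]
      refine splitSum_eq_zero fun p q _ => ?_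
      have hp := hmσ (x :: p)
      rw [List.map_cons] at hp
      rw [hp, ← insFamily_add]
      simp only [(hF.head _).map_neg, add_neg_cancel, insFamily_zero]
    calc _ = (splitSum (fun w q => splitSum (fun u v => F (m (m (x :: u) :: v) :: q)) w) xs +
        splitSum (fun w q => insFamily σ (fun p => F (m (σ x :: p) :: q)) m w) xs) +
        (splitSum (fun p q => insFamily σ (fun l => F (σ (m (x :: p)) :: l)) m q) xs +
        splitSum (fun p q => insFamily σ (fun q => F (m (σ x :: p.map σ) :: q)) m q) xs) := by
          abel
      _ = 0 := by rw [e₁, e₂, add_zero]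

/-! ### The defect of a family of maps that need not be an `A_∞`-morphism. -/

section Defect

variable {σ : A →ₗ[k] A} {τ : B →ₗ[k] B} {m : List A → A} {n : List B → B} {h : List A → B}

/-- The failure of `h` to be an `A_∞`-morphism, composed with `F`. -/
theorem compFamily_insFamily_cons {F : List B → M} (hF : IsMultilinear k F)
    (hm₀ : m [] = 0) (hn₀ : n [] = 0)
    (hh : IsMultilinear k h) (hhσ : ∀ xs, h (xs.map σ) = τ (h xs)) (x : A) (xs : List A) :
    compFamily (insFamily τ F n) h (x :: xs) - insFamily σ (compFamily F h) m (x :: xs) =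
      splitSum (fun w v => compFamily (fun l =>
        F ((compFamily n h (x :: w) - insFamily σ h m (x :: w)) :: l)) h v) xs +
      splitSum (fun u v => compFamily (insFamily τ (fun l => F (τ (h (x :: u)) :: l)) n) h v -
        insFamily σ (compFamily (fun l => F (τ (h (x :: u)) :: l)) h) m v) xs := by
  have hL : ∀ v, IsLinearMap k fun y => compFamily (fun l => F (y :: l)) h v :=
    fun v => isLinearMap_compFamily (fun l => hF.head l) _ _
  -- Terms are sorted by whether `n` absorbs the first block; when it does, its inputs form a
  -- blocking of an initial segment `x :: w`.
  have e₁ : compFamily (insFamily τ F n) h (x :: xs) =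
      splitSum (fun w v => compFamily (fun l => F (compFamily n h (x :: w) :: l)) h v) xs +
      splitSum (fun u v =>
        compFamily (insFamily τ (fun l => F (τ (h (x :: u)) :: l)) n) h v) xs := by
    rw [compFamily_cons]
    simp only [insFamily_cons_of_nil hF τ hn₀, compFamily_add, splitSum_add]
    congr 1
    have e : ∀ u v, compFamily (fun l => splitSum (fun p q => F (n (h (x :: u) :: p) :: q)) l) h v =
        splitSum (fun v₁ v₂ => compFamily (fun p => compFamily (fun q =>
          F (n (h (x :: u) :: p) :: q)) h v₂) h v₁) v := fun u v => compFamily_splitSum _ _ _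
    rw [splitSum_congr fun u v _ => e u v, splitSum_assoc]
    refine splitSum_congr fun w v _ => ?_
    rw [compFamily_cons, IsLinearMap.map_splitSum (hL v)]
    refine splitSum_congr fun u v₁ _ => ?_
    rw [IsLinearMap.map_compFamily (hL v)]
  -- Likewise, terms are sorted by whether `m` acts inside the first block; otherwise that block is
  -- passed with the sign `τ`.
  have e₂ : insFamily σ (compFamily F h) m (x :: xs) =
      splitSum (fun w v => compFamily (fun l => F (insFamily σ h m (x :: w) :: l)) h v) xs +
      splitSum (fun u v =>
        insFamily σ (compFamily (fun l => F (τ (h (x :: u)) :: l)) h) m v) xs := by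
    rw [insFamily_cons_of_nil (hF.compFamily hh) σ hm₀]
    simp only [compFamily_cons]
    have e : insFamily σ (fun l => splitSum (fun u v =>
          compFamily (fun l => F (h (σ x :: u) :: l)) h v) l) m xs =
        splitSum (fun u v => insFamily σ (fun p =>
            compFamily (fun l => F (h (σ x :: p) :: l)) h v) m u +
          insFamily σ (fun q => compFamily (fun l => F (h (σ x :: u.map σ) :: l)) h q) m v) xs :=
      insFamily_splitSum _ _ _ _
    rw [e, splitSum_add, ← add_assoc, splitSum_assoc, ← splitSum_add]
    congr 1
    · refine splitSum_congr fun w v _ => ?_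
      rw [insFamily_cons_of_nil hh σ hm₀, (hL v).map_add, IsLinearMap.map_splitSum (hL v),
        IsLinearMap.map_insFamily (hL v)]
    · refine splitSum_congr fun u v _ => ?_
      have hp := hhσ (x :: u)
      rw [List.map_cons] at hp
      rw [hp]
  rw [e₁, e₂, add_sub_add_comm, sub_eq_add_neg (splitSum _ xs), sub_eq_add_neg (splitSum _ xs)]
  have hneg : ∀ (Φ : List A → List A → M),
      -splitSum Φ xs = splitSum (fun u v => -Φ u v) xs := fun Φ =>
    IsLinearMap.map_splitSum (k := k) (L := fun y : M => -y)
      ⟨fun a b => neg_add a b, fun c a => (smul_neg c a).symm⟩ Φ xs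
  simp only [hneg, ← splitSum_add, (hL _).map_sub, ← sub_eq_add_neg]

theorem compFamily_insFamily_of_forall {F : List B → M} (hF : IsMultilinear k F)
    (hm₀ : m [] = 0) (hn₀ : n [] = 0)
    (hh : IsMultilinear k h) (hhσ : ∀ xs, h (xs.map σ) = τ (h xs)) (xs : List A)
    (hδ : ∀ u, u.length ≤ xs.length → compFamily n h u = insFamily σ h m u) :
    compFamily (insFamily τ F n) h xs = insFamily σ (compFamily F h) m xs := by
  rw [← sub_eq_zero]
  induction hl : xs.length using Nat.strong_induction_on generalizing xs F with
  | _ N ih =>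
    cases xs with
    | nil =>
      have h0 : h [0] = 0 := hh.map_zero_entry [] []
      simp [hn₀, hm₀, compFamily_cons, h0]
    | cons x xs =>
      rw [compFamily_insFamily_cons hF hm₀ hn₀ hh hhσ, splitSum_eq_zero, splitSum_eq_zero,
        add_zero]
      · intro u v huv
        have : u.length + v.length = xs.length := by simp [← huv]
        simp only [List.length_cons] at hl hδ
        exact ih v.length (by omega) (hF.cons _) v (fun u hu => hδ u (by omega)) rfl
      · intro u v huv
        rw [hδ (x :: u) (by simp [← huv]), sub_self]
        simp only [(hF.head _).map_zero, compFamily_zero]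

/-- The obstruction formula. Each term of `F ∘ (n̂ ∘ ĥ - ĥ ∘ m̂)` contains the defect of one
consecutive sublist; if shorter lists have no defect, only the whole list contributes, and it enters
`F` as a single argument. -/
theorem compFamily_insFamily_of_forall_lt {F : List B → M} (hF : IsMultilinear k F)
    (hm₀ : m [] = 0) (hn₀ : n [] = 0)
    (hh : IsMultilinear k h) (hhσ : ∀ xs, h (xs.map σ) = τ (h xs)) (xs : List A)
    (hδ : ∀ u, u.length < xs.length → compFamily n h u = insFamily σ h m u) :
    compFamily (insFamily τ F n) h xs - insFamily σ (compFamily F h) m xs =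
      F [compFamily n h xs - insFamily σ h m xs] := by
  cases xs with
  | nil =>
    have h0 : h [0] = 0 := hh.map_zero_entry [] []
    have hF0 : F [0] = 0 := hF.map_zero_entry [] []
    simp [hn₀, hm₀, compFamily_cons, h0, hF0]
  | cons x xs =>
    rw [compFamily_insFamily_cons hF hm₀ hn₀ hh hhσ, splitSum_eq_full,
      splitSum_eq_zero (M := M), add_zero, compFamily_nil]
    · intro u v huv
      have : u.length + v.length = xs.length := by simp [← huv]
      simp only [List.length_cons] at hδ
      rw [compFamily_insFamily_of_forall (hF.cons _) hm₀ hn₀ hh hhσ v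
        (fun u hu => hδ u (by omega)), sub_self]
    · intro u v huv hu
      rw [hδ (x :: u) (by simpa using hu), sub_self]
      simp only [(hF.head _).map_zero, compFamily_zero]

end Defect

end Coalgebra

/-! ### Degrees, signs and homogeneous parts of maps. -/

section Degrees

variable {k : Type*} [Field k] {A B C : Type*} [AddCommGroup A] [Module k A]
  [AddCommGroup B] [Module k B] [AddCommGroup C] [Module k C]
  {G : Grading k A} {G' : Grading k B} {G'' : Grading k C}

/-- The family `F` has shifted degree `e`. -/
def HasDegree (G : Grading k A) (G' : Grading k B) (e : ℤ) (F : List A → B) : Prop :=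
  ∀ ds xs, G.Homog ds xs → F xs ∈ G'.sdeg (ds.sum + e)

theorem Grading.Homog.of_append {ds : List ℤ} {u v : List A} (h : G.Homog ds (u ++ v)) :
    ∃ ds₁ ds₂, ds = ds₁ ++ ds₂ ∧ G.Homog ds₁ u ∧ G.Homog ds₂ v := by
  induction u generalizing ds with
  | nil => exact ⟨[], ds, rfl, .nil, h⟩
  | cons x u ih =>
    cases h with
    | cons hx h =>
      obtain ⟨ds₁, ds₂, rfl, h₁, h₂⟩ := ih h
      exact ⟨_ :: ds₁, ds₂, rfl, .cons hx h₁, h₂⟩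

theorem Grading.sign_mem (G : Grading k A) {d : ℤ} {x : A} (hx : x ∈ G.sdeg d) :
    G.sign x ∈ G.sdeg d := by
  rw [G.sign_of_mem hx]
  exact Submodule.smul_mem _ _ hx

theorem Grading.Homog.map_sign {ds : List ℤ} {u : List A} (h : G.Homog ds u) :
    G.Homog ds (u.map G.sign) := by
  induction h with
  | nil => exact .nil
  | cons hx _ ih => exact .cons (G.sign_mem hx) ih

theorem neg_one_zpow_mul_self (e : ℤ) : (-1 : k) ^ e * (-1 : k) ^ e = 1 := by
  rw [← mul_zpow]; simp

theorem Grading.linearMap_ext_sdeg {f g : A →ₗ[k] B} (h : ∀ i, ∀ x ∈ G.sdeg i, f x = g x) :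
    f = g :=
  G.linearMap_ext fun i x hx => h (i - 1) x (by simpa [Grading.sdeg] using hx)

theorem Grading.sign_sign (G : Grading k A) (x : A) : G.sign (G.sign x) = x := by
  have : G.sign ∘ₗ G.sign = LinearMap.id := Grading.linearMap_ext_sdeg fun i x hx => by
    rw [LinearMap.comp_apply, G.sign_of_mem hx, map_smul, G.sign_of_mem hx, smul_smul,
      neg_one_zpow_mul_self, one_smul, LinearMap.id_apply]
  exact LinearMap.congr_fun this x

/-- Homogeneous elements span, so the entries can be made homogeneous one at a time. -/
theorem IsMultilinear.ext {F F' : List A → B} (hF : IsMultilinear k F) (hF' : IsMultilinear k F')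
    (G : Grading k A) (h : ∀ ds xs, G.Homog ds xs → F xs = F' xs) : F = F' := by
  have key : ∀ (v : List A) (F F' : List A → B), IsMultilinear k F → IsMultilinear k F' →
      (∀ ds xs, G.Homog ds xs → F xs = F' xs) → F v = F' v := by
    intro v
    induction v with
    | nil => exact fun F F' _ _ h => h [] [] .nil
    | cons x v ih =>
      intro F F' hF hF' h
      have e : (hF.head v).mk' _ = (hF'.head v).mk' _ :=
        Grading.linearMap_ext_sdeg (G := G) fun i x hx =>
          ih _ _ (hF.cons x) (hF'.cons x) fun ds xs hxs => h _ _ (.cons hx hxs)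
      exact LinearMap.congr_fun e x
  exact funext fun v => key v F F' hF hF' h

theorem IsMultilinear.map_sign_of_homog {F : List A → B} (hF : IsMultilinear k F) {ds : List ℤ}
    {xs : List A} (h : G.Homog ds xs) : F (xs.map G.sign) = (-1 : k) ^ ds.sum • F xs := by
  induction h generalizing F with
  | nil => simp
  | @cons d x ds xs hx h ih =>
    rw [List.map_cons, G.sign_of_mem hx, (hF.head _).map_smul, ih (hF.cons x), smul_smul,
      List.sum_cons, zpow_add₀ (by simp)]

theorem isMultilinear_comp_map {F : List B → C} (hF : IsMultilinear k F) (g : A →ₗ[k] B) :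
    IsMultilinear k fun xs => F (xs.map g) := by
  intro u v
  simp only [List.map_append, List.map_cons]
  exact isLinearMap_comp (g := fun y => F (u.map g ++ y :: v.map g)) (hF _ _) g.isLinear

/-- This turns a degree statement about homogeneous lists into an identity for all lists, the form
in which the sign hypotheses of the coalgebra lemmas are stated. -/
theorem HasDegree.map_sign {e : ℤ} {F : List A → B} (hd : HasDegree G G' e F)
    (hF : IsMultilinear k F) (xs : List A) :
    F (xs.map G.sign) = (-1 : k) ^ e • G'.sign (F xs) := by
  refine congrFun (IsMultilinear.ext (F := fun xs => F (xs.map G.sign))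
    (F' := fun xs => (-1 : k) ^ e • G'.sign (F xs)) (isMultilinear_comp_map hF _)
    (fun u v => isLinearMap_comp (g := fun y => (-1 : k) ^ e • G'.sign y)
      ((-1 : k) ^ e • G'.sign).isLinear (hF u v)) G ?_) xs
  intro ds xs h
  rw [hF.map_sign_of_homog h, G'.sign_of_mem (hd _ _ h), smul_smul, zpow_add₀ (by simp),
    mul_left_comm, neg_one_zpow_mul_self, mul_one]

theorem HasDegree.cons {e d : ℤ} {F : List A → B} (hd : HasDegree G G' e F) {y : A}
    (hy : y ∈ G.sdeg d) : HasDegree G G' (e + d) fun l => F (y :: l) := by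
  intro ds xs h
  have := hd _ _ (.cons hy h)
  rw [List.sum_cons] at this
  convert this using 2
  ring

theorem HasDegree.compFamily {e : ℤ} {F : List B → C} (hF : HasDegree G' G'' e F)
    {h : List A → B} (hh : HasDegree G G' 0 h) : HasDegree G G'' e (compFamily F h) := by
  intro ds xs hx
  induction hn : xs.length using Nat.strong_induction_on generalizing e F ds xs with
  | _ n ih =>
    cases hx with
    | nil => simpa using hF [] [] .nil
    | @cons d x ds xs hx hxs =>
      rw [compFamily_cons]
      refine splitSum_mem fun u v huv => ?_
      subst huv
      obtain ⟨ds₁, ds₂, rfl, h₁, h₂⟩ := Grading.Homog.of_append hxs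
      have := ih v.length (by subst hn; simp) (hF.cons (hh _ _ (.cons hx h₁))) _ _ h₂ rfl
      convert this using 2
      simp
      ring

theorem HasDegree.insFamily {e e' : ℤ} {F : List A → B} (hF : HasDegree G G' e F)
    {m : List A → A} (hm : HasDegree G G e' m) :
    HasDegree G G' (e + e') (insFamily G.sign F m) := by
  intro ds xs hx
  induction hx generalizing e F with
  | nil =>
    have := hF _ _ (.cons (hm _ _ .nil) .nil)
    rw [insFamily_nil]
    convert this using 2
    simp
    ring
  | @cons d x ds xs hx hxs ih =>
    rw [insFamily_cons]
    refine Submodule.add_mem _ (splitSum_mem fun u v huv => ?_) ?_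
    · have hxs' : G.Homog (d :: ds) (x :: xs) := .cons hx hxs
      rw [← huv] at hxs'
      obtain ⟨ds₁, ds₂, hds, h₁, h₂⟩ := Grading.Homog.of_append hxs'
      have := hF _ _ (.cons (hm _ _ h₁) h₂)
      rw [hds]
      convert this using 2
      simp
      ring
    · have := ih (hF.cons (G.sign_mem hx))
      convert this using 2
      simp
      ring

theorem isMultilinear_idFamily : IsMultilinear k (idFamily : List A → A) := by
  intro u v
  rcases u with _ | ⟨x, _ | ⟨y, u⟩⟩ <;> rcases v with _ | ⟨z, v⟩ <;>
    exact ⟨by simp [idFamily], by simp [idFamily]⟩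

theorem hasDegree_idFamily : HasDegree G G 0 (idFamily : List A → A) := by
  intro ds xs h
  rcases h with _ | ⟨hx, _ | ⟨_, _⟩⟩
  · exact Submodule.zero_mem _
  · simpa [idFamily] using hx
  · exact Submodule.zero_mem _

theorem compFamily_idFamily {F : List A → B} (hF : IsMultilinear k F) (xs : List A) :
    compFamily F idFamily xs = F xs := by
  induction xs generalizing F with
  | nil => simp
  | cons x xs ih =>
    rw [compFamily_cons, splitSum_eq_empty]
    · exact ih (hF.cons x)
    · intro u v _ hu
      obtain ⟨y, u, rfl⟩ := List.exists_cons_of_ne_nil hu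
      simp only [idFamily, (hF.head _).map_zero, compFamily_zero]

theorem insFamily_idFamily (σ : A → A) (m : List A → A) (xs : List A) :
    insFamily σ idFamily m xs = m xs := by
  rw [insFamily_eq_splitSum, splitSum_eq_empty, splitSum_eq_full]
  · rfl
  · intro u v huv hu
    rcases v with _ | ⟨y, v⟩
    · simp at huv; simp [huv] at hu
    · rfl
  · intro u v _ hu
    obtain ⟨y, u, rfl⟩ := List.exists_cons_of_ne_nil hu
    refine splitSum_eq_zero fun p q _ => ?_
    rcases u with _ | ⟨z, u⟩ <;> rfl

/-- The homogeneous part of degree `e` of a linear map. -/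
noncomputable def Grading.homogenize (G : Grading k A) (G' : Grading k B) (e : ℤ) (g : A →ₗ[k] B) :
    A →ₗ[k] B :=
  (DirectSum.toModule k ℤ B fun i => G'.proj (i + e) ∘ₗ g ∘ₗ (G.deg i).subtype) ∘ₗ
    G.decomp.toLinearMap

theorem Grading.homogenize_of_mem (g : A →ₗ[k] B) (e : ℤ) {i : ℤ} {x : A} (hx : x ∈ G.deg i) :
    G.homogenize G' e g x = G'.proj (i + e) (g x) := by
  simp [homogenize, G.decomp_of_mem hx, DirectSum.toModule_lof]

theorem Grading.homogenize_mem (g : A →ₗ[k] B) (e : ℤ) {i : ℤ} {x : A} (hx : x ∈ G.sdeg i) :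
    G.homogenize G' e g x ∈ G'.sdeg (i + e) := by
  rw [Grading.homogenize_of_mem g e hx]
  have := G'.proj_mem (i + 1 + e) (g x)
  rwa [add_right_comm i 1 e] at this ⊢

theorem Grading.map_proj {e : ℤ} {g : A →ₗ[k] B} (hg : ∀ i, ∀ x ∈ G.deg i, g x ∈ G'.deg (i + e))
    (i : ℤ) (x : A) : g (G.proj i x) = G'.proj (i + e) (g x) := by
  have : g ∘ₗ G.proj i = G'.proj (i + e) ∘ₗ g := G.linearMap_ext fun j x hx => by
    simp only [LinearMap.comp_apply]
    rw [G.proj_of_mem i hx, G'.proj_of_mem (i + e) (hg j x hx)]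
    by_cases hij : j = i
    · simp only [hij, if_true]
    · rw [if_neg hij, if_neg (by omega), map_zero]
  exact LinearMap.congr_fun this x

theorem Grading.mem_of_proj_mem {K : Submodule k A} {x : A} (h : ∀ i, G.proj i x ∈ K) : x ∈ K := by
  classical
  have hsum : x = ∑ i ∈ (G.decomp x).support, G.proj i x :=
    (G.decomp.symm_apply_apply x).symm.trans
      (DirectSum.coeLinearMap_eq_dfinsuppSum G.deg (G.decomp x))
  rw [hsum]
  exact Submodule.sum_mem _ fun i _ => h i

end Degrees

/-! ### Recursion on the number of inputs. -/

section Truncation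

variable {k : Type*} [Field k] {A B M : Type*} [AddCommGroup A] [Module k A]
  [AddCommGroup B] [Module k B] [AddCommGroup M] [Module k M] {G : Grading k A} {G' : Grading k B}

/-- The components of a family in fewer than `n` variables. -/
def truncate (n : ℕ) (h : List B → A) : List B → A :=
  fun l => if l.length < n then h l else 0

theorem truncate_of_lt {n : ℕ} (h : List B → A) {l : List B} (hl : l.length < n) :
    truncate n h l = h l := if_pos hl

theorem truncate_of_le {n : ℕ} (h : List B → A) {l : List B} (hl : n ≤ l.length) :
    truncate n h l = 0 := if_neg (by omega)

/-- Recursion on the number of variables. -/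
noncomputable def lengthRec (T : (List B → A) → List B → A) (xs : List B) : A :=
  T (fun l => if _ : l.length < xs.length then lengthRec T l else 0) xs
termination_by xs.length

theorem lengthRec_eq (T : (List B → A) → List B → A) (xs : List B) :
    lengthRec T xs = T (truncate xs.length (lengthRec T)) xs := by
  rw [lengthRec]
  congr 1

theorem IsMultilinear.truncate {h : List B → A} (hh : IsMultilinear k h) (n : ℕ) :
    IsMultilinear k (truncate n h) := by
  intro u v
  by_cases hl : u.length + v.length + 1 < n
  · have : (fun x => AInfty.truncate n h (u ++ x :: v)) = fun x => h (u ++ x :: v) :=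
      funext fun x => truncate_of_lt _ (by simp; omega)
    rw [this]
    exact hh u v
  · have : (fun x => AInfty.truncate n h (u ++ x :: v)) = fun x => (0 : B →ₗ[k] A) x :=
      funext fun x => truncate_of_le _ (by simp; omega)
    rw [this]
    exact (0 : B →ₗ[k] A).isLinear

theorem isMultilinear_of_truncate {h : List B → A} (hh : ∀ n, IsMultilinear k (truncate n h)) :
    IsMultilinear k h := by
  intro u v
  have : (fun x => h (u ++ x :: v)) =
      fun x => truncate (u.length + v.length + 2) h (u ++ x :: v) :=
    funext fun x => (truncate_of_lt _ (by simp; omega)).symm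
  rw [this]
  exact hh _ u v

/-- Linearity at a given length uses only the truncation below that length, so strong induction runs
over the truncations. -/
theorem isMultilinear_lengthRec {T : (List B → A) → List B → A}
    (hT : ∀ g, IsMultilinear k g → IsMultilinear k (T g)) : IsMultilinear k (lengthRec T) := by
  refine isMultilinear_of_truncate fun n => ?_
  induction n using Nat.strong_induction_on with
  | _ n ih =>
    intro u v
    by_cases hl : u.length + v.length + 1 < n
    · have : (fun x => truncate n (lengthRec T) (u ++ x :: v)) =
          fun x => T (truncate (u.length + v.length + 1) (lengthRec T)) (u ++ x :: v) :=
        funext fun x => by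
          rw [truncate_of_lt _ (by simp; omega), lengthRec_eq]
          simp [add_assoc]
      rw [this]
      exact hT _ (ih _ hl) u v
    · have : (fun x => truncate n (lengthRec T) (u ++ x :: v)) = fun x => (0 : B →ₗ[k] A) x :=
        funext fun x => truncate_of_le _ (by simp; omega)
      rw [this]
      exact (0 : B →ₗ[k] A).isLinear

theorem hasDegree_lengthRec {e : ℤ} {T : (List B → A) → List B → A}
    (hT : ∀ g, HasDegree G' G e g → HasDegree G' G e (T g)) : HasDegree G' G e (lengthRec T) := by
  intro ds xs hx
  induction hn : xs.length using Nat.strong_induction_on generalizing ds xs with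
  | _ n ih =>
    rw [lengthRec_eq]
    refine hT _ (fun es ys hy => ?_) ds xs hx
    by_cases hl : ys.length < xs.length
    · rw [truncate_of_lt _ hl]
      exact ih _ (hn ▸ hl) es ys hy rfl
    · rw [truncate_of_le _ (by omega)]
      exact Submodule.zero_mem _

/-- Only the blocking with a single block evaluates `h` on the full list. This isolates the unknown
`h_n` as `F₁(h_n)`. -/
theorem compFamily_eq_add_truncate {F : List A → M} (hF : IsMultilinear k F) (h : List B → A)
    {xs : List B} (hxs : xs ≠ []) :
    compFamily F h xs = F [h xs] + compFamily F (truncate xs.length h) xs := by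
  obtain ⟨x, xs, rfl⟩ := List.exists_cons_of_ne_nil hxs
  set g := truncate (x :: xs).length h with hg
  rw [← sub_eq_iff_eq_add, compFamily_cons, compFamily_cons]
  have e : ∀ Φ Ψ : List B → List B → M, splitSum Φ xs - splitSum Ψ xs =
      splitSum (fun u v => Φ u v - Ψ u v) xs := fun Φ Ψ => by
    rw [sub_eq_iff_eq_add, ← splitSum_add]
    simp
  rw [e, splitSum_eq_full]
  · rw [hg, truncate_of_le h (le_refl _)]
    simp [(hF.head []).map_zero]
  · intro u v huv hu
    have : u.length + v.length = xs.length := by simp [← huv]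
    rw [hg, truncate_of_lt h (l := x :: u) (by simpa using hu), sub_eq_zero]
    exact compFamily_congr
      (fun w hw => (truncate_of_lt h (by simp only [List.length_cons]; omega)).symm)
      (fun _ _ => rfl)

/-- Without `m₀` and `m₁`, every insertion consumes at least two entries and so shortens the list.
This is where minimality makes the recursion explicit. -/
theorem insFamily_eq_truncate {F : List B → M} (hF : IsMultilinear k F) (σ : B → B)
    {m : List B → B} (hm₀ : m [] = 0) (hm₁ : ∀ x, m [x] = 0) (xs : List B) :
    insFamily σ F m xs = insFamily σ (truncate xs.length F) m xs := by
  rw [insFamily_eq_splitSum, insFamily_eq_splitSum]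
  refine splitSum_congr fun u v huv => splitSum_congr fun p q hpq => ?_
  rcases p with _ | ⟨x, _ | ⟨y, p⟩⟩
  · rw [hm₀, hF.map_zero_entry, (hF.truncate _).map_zero_entry]
  · rw [hm₁, hF.map_zero_entry, (hF.truncate _).map_zero_entry]
  · rw [truncate_of_lt]
    subst hpq huv
    simp

end Truncation

/-! ### Strict right inverses of quasi-isomorphisms to minimal algebras. -/

section QuasiIso

variable {k : Type*} [Field k] {A B : Type*} [AddCommGroup A] [Module k A]
  [AddCommGroup B] [Module k B] {G : Grading k A} {G' : Grading k B} {𝔸 : Alg G} {𝔹 : Alg G'}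

theorem Alg.toCoh_eq_zero_iff (𝔸 : Alg G) (z : LinearMap.ker 𝔸.d) :
    𝔸.toCoh z = 0 ↔ ∃ y, 𝔸.d y = z := by
  rw [Alg.toCoh, Submodule.mkQ_apply, Submodule.Quotient.mk_eq_zero]
  rfl

theorem Hom.linear_mem (f : Hom 𝔸 𝔹) (i : ℤ) (x : A) (hx : x ∈ G.deg i) :
    f.linear x ∈ G'.deg (i + 0) := by
  have h := f.degree [i - 1] [x] (by simpa [Grading.Homog, Grading.sdeg] using hx)
  simpa [Grading.sdeg, Hom.linear] using h

theorem Hom.linear_d_of_isMinimal (f : Hom 𝔸 𝔹) (hmin : 𝔹.IsMinimal) (x : A) :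
    f.linear (𝔸.d x) = 0 := by
  rw [f.linear_d]; exact hmin _

theorem Hom.IsQuasiIso.exists_cocycle {f : Hom 𝔸 𝔹} (hf : f.IsQuasiIso) (hmin : 𝔹.IsMinimal)
    (y : B) : ∃ z, 𝔸.d z = 0 ∧ f.linear z = y := by
  obtain ⟨c, hc⟩ := hf.2 (𝔹.toCoh ⟨y, hmin y⟩)
  obtain ⟨z, rfl⟩ := Submodule.mkQ_surjective _ c
  refine ⟨z, z.2, ?_⟩
  have h : 𝔹.toCoh (⟨f.linear z, hmin _⟩ - ⟨y, hmin y⟩) = 0 := by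
    rw [map_sub, sub_eq_zero]; exact hc
  obtain ⟨w, hw⟩ := (𝔹.toCoh_eq_zero_iff _).1 h
  rw [show 𝔹.d w = 0 from hmin w] at hw
  exact sub_eq_zero.1 hw.symm

/-- Acyclicity of `ker f₁`: injectivity on cohomology gives some primitive, and subtracting a
cocycle with the same image under `f₁` moves it into `ker f₁`. -/
theorem Hom.IsQuasiIso.exists_primitive {f : Hom 𝔸 𝔹} (hf : f.IsQuasiIso) (hmin : 𝔹.IsMinimal)
    {z : A} (hz : 𝔸.d z = 0) (hfz : f.linear z = 0) : ∃ y, f.linear y = 0 ∧ 𝔸.d y = z := by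
  have h : 𝔸.toCoh ⟨z, hz⟩ = 0 := by
    apply hf.1
    rw [map_zero]
    refine (𝔹.toCoh_eq_zero_iff ⟨f.linear z, hmin _⟩).2 ⟨0, ?_⟩
    rw [map_zero]
    exact hfz.symm
  obtain ⟨y, hy⟩ := (𝔸.toCoh_eq_zero_iff _).1 h
  obtain ⟨c, hc, hcy⟩ := hf.exists_cocycle hmin (f.linear y)
  exact ⟨y - c, by rw [map_sub, hcy, sub_self], by rw [map_sub, hc, sub_zero, hy]⟩

/-- A graded section of the linear part of `f` by cocycles. -/
theorem Hom.IsQuasiIso.exists_section {f : Hom 𝔸 𝔹} (hf : f.IsQuasiIso) (hmin : 𝔹.IsMinimal) :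
    ∃ g : B →ₗ[k] A, (∀ i, ∀ x ∈ G'.sdeg i, g x ∈ G.sdeg i) ∧ (∀ x, f.linear (g x) = x) ∧
      ∀ x, 𝔸.d (g x) = 0 := by
  obtain ⟨g₀, hg₀⟩ := (f.linear ∘ₗ (LinearMap.ker 𝔸.d).subtype).exists_rightInverse_of_surjective
    (LinearMap.range_eq_top.2 fun y => by
      obtain ⟨z, hz, hzy⟩ := hf.exists_cocycle hmin y
      exact ⟨⟨z, hz⟩, hzy⟩)
  refine ⟨G'.homogenize G 0 ((LinearMap.ker 𝔸.d).subtype ∘ₗ g₀), fun i x hx => ?_, ?_, ?_⟩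
  · simpa using Grading.homogenize_mem (G' := G) ((LinearMap.ker 𝔸.d).subtype ∘ₗ g₀) 0 hx
  · have : f.linear ∘ₗ G'.homogenize G 0 ((LinearMap.ker 𝔸.d).subtype ∘ₗ g₀) = LinearMap.id :=
      G'.linearMap_ext fun i x hx => by
        rw [LinearMap.comp_apply, Grading.homogenize_of_mem _ _ hx, Grading.map_proj f.linear_mem]
        have := LinearMap.congr_fun hg₀ x
        simp only [LinearMap.comp_apply, LinearMap.id_apply] at this ⊢
        rw [this, G'.proj_of_mem _ hx]
        simp
    exact LinearMap.congr_fun this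
  · have : 𝔸.d ∘ₗ G'.homogenize G 0 ((LinearMap.ker 𝔸.d).subtype ∘ₗ g₀) = 0 :=
      G'.linearMap_ext fun i x hx => by
        rw [LinearMap.comp_apply, Grading.homogenize_of_mem _ _ hx, 𝔸.d_proj]
        simp
    exact LinearMap.congr_fun this

/-- A graded homotopy contracting the kernel of the linear part of `f`. -/
theorem Hom.IsQuasiIso.exists_contraction {f : Hom 𝔸 𝔹} (hf : f.IsQuasiIso)
    (hmin : 𝔹.IsMinimal) :
    ∃ s : A →ₗ[k] A, (∀ i, ∀ x ∈ G.sdeg (i + 1), s x ∈ G.sdeg i) ∧ (∀ x, f.linear (s x) = 0) ∧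
      ∀ x, 𝔸.d x = 0 → f.linear x = 0 → 𝔸.d (s x) = x := by
  let K := LinearMap.ker f.linear
  let Z := LinearMap.ker 𝔸.d ⊓ K
  let δ : K →ₗ[k] Z := (𝔸.d ∘ₗ K.subtype).codRestrict Z fun y =>
    ⟨𝔸.d_d y, f.linear_d_of_isMinimal hmin y⟩
  obtain ⟨t, ht⟩ := δ.exists_rightInverse_of_surjective (LinearMap.range_eq_top.2 fun z => by
    obtain ⟨y, hy, hyz⟩ := hf.exists_primitive hmin z.2.1 z.2.2
    exact ⟨⟨y, hy⟩, Subtype.ext hyz⟩)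
  -- The values of `s` outside `ker d ∩ ker f₁` are irrelevant, apart from lying in `ker f₁`, so any
  -- linear extension serves.
  obtain ⟨t', ht'⟩ := LinearMap.exists_extend t
  set s₀ : A →ₗ[k] A := K.subtype ∘ₗ t'
  have hs₀ : ∀ x, f.linear (s₀ x) = 0 := fun x => (t' x).2
  have hds₀ : ∀ x, 𝔸.d x = 0 → f.linear x = 0 → 𝔸.d (s₀ x) = x := fun x h₁ h₂ => by
    have e₁ : t' x = t ⟨x, h₁, h₂⟩ := LinearMap.congr_fun ht' ⟨x, h₁, h₂⟩
    have e₂ := congrArg Subtype.val (LinearMap.congr_fun ht ⟨x, h₁, h₂⟩)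
    change 𝔸.d (t ⟨x, h₁, h₂⟩ : A) = x at e₂
    rw [← e₁] at e₂
    exact e₂
  refine ⟨G.homogenize G (-1) s₀, fun i x hx => ?_, ?_, fun x h₁ h₂ => ?_⟩
  · simpa using Grading.homogenize_mem (G' := G) s₀ (-1) hx
  · have : f.linear ∘ₗ G.homogenize G (-1) s₀ = 0 := G.linearMap_ext fun i x hx => by
      rw [LinearMap.comp_apply, Grading.homogenize_of_mem _ _ hx, Grading.map_proj f.linear_mem,
        hs₀]
      simp
    exact LinearMap.congr_fun this
  -- Both `d` and `f₁` commute with the projections, so each homogeneous component of `x` lies again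
  -- in `ker d ∩ ker f₁` and may be treated separately.
  · have key : x ∈ LinearMap.eqLocus (𝔸.d ∘ₗ G.homogenize G (-1) s₀) LinearMap.id := by
      refine Grading.mem_of_proj_mem (G := G) fun i => ?_
      have hi : 𝔸.d (s₀ (G.proj i x)) = G.proj i x :=
        hds₀ _ (by rw [𝔸.d_proj, h₁, map_zero]) (by rw [Grading.map_proj f.linear_mem, h₂, map_zero])
      change 𝔸.d (G.homogenize G (-1) s₀ (G.proj i x)) = G.proj i x
      rw [Grading.homogenize_of_mem _ _ (G.proj_mem i x), 𝔸.d_proj, hi,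
        G.proj_of_mem _ (G.proj_mem i x)]
      simp
    exact key

theorem Alg.insFamily_self (𝔸 : Alg G) (xs : List A) : insFamily G.sign 𝔸.m 𝔸.m xs = 0 :=
  𝔸.rel xs

theorem Alg.hasDegree (𝔸 : Alg G) : HasDegree G G 1 𝔸.m := 𝔸.degree

theorem Alg.map_sign (𝔸 : Alg G) (xs : List A) : 𝔸.m (xs.map G.sign) = -G.sign (𝔸.m xs) := by
  simp [𝔸.hasDegree.map_sign 𝔸.multilinear]

theorem Hom.hasDegree (f : Hom 𝔸 𝔹) : HasDegree G G' 0 f.f := fun ds xs h => by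
  simpa using f.degree ds xs h

theorem Hom.map_sign (f : Hom 𝔸 𝔹) (xs : List A) : f.f (xs.map G.sign) = G'.sign (f.f xs) := by
  simp [f.hasDegree.map_sign f.multilinear]

theorem Hom.insFamily_eq (f : Hom 𝔸 𝔹) (xs : List A) :
    insFamily G.sign f.f 𝔸.m xs = compFamily 𝔹.m f.f xs := f.rel xs

/-- An `A_∞`-quasi-isomorphism to a minimal `A_∞`-algebra has a right inverse. -/
theorem Hom.IsQuasiIso.exists_rightInverse {f : Hom 𝔸 𝔹} (hf : f.IsQuasiIso)
    (hmin : 𝔹.IsMinimal) : ∃ h : Hom 𝔹 𝔸, compFamily f.f h.f = idFamily := by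
  obtain ⟨ι, hι, hfι, hdι⟩ := hf.exists_section hmin
  obtain ⟨s, hs, hfs, hds⟩ := hf.exists_contraction hmin
  let E : (List B → A) → List B → A := fun g xs =>
    insFamily G'.sign g 𝔹.m xs - compFamily 𝔸.m g xs
  -- Here `g` will be the part `h_{<n}` already built; `ι` corrects `f ∘ g` to the identity and `s`
  -- corrects the defect `E g`.
  let T : (List B → A) → List B → A := fun g xs =>
    ι (idFamily xs - compFamily f.f g xs) + s (E g xs)
  set h := lengthRec T with hh
  have hrec : ∀ xs, h xs = T (truncate xs.length h) xs := lengthRec_eq T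
  have hmul : IsMultilinear k h := isMultilinear_lengthRec fun g hg u v =>
    isLinearMap_add
      (isLinearMap_comp ι.isLinear
        ((isMultilinear_idFamily u v).mk' _ - (f.multilinear.compFamily hg u v).mk' _).isLinear)
      (isLinearMap_comp s.isLinear
        ((hg.insFamily G'.sign 𝔹.multilinear 𝔹.nil u v).mk' _ -
          (𝔸.multilinear.compFamily hg u v).mk' _).isLinear)
  have hdeg : HasDegree G' G 0 h := hasDegree_lengthRec fun g hg ds xs hx =>
    Submodule.add_mem _
      (hι _ _ (Submodule.sub_mem _ (hasDegree_idFamily _ _ hx) (f.hasDegree.compFamily hg _ _ hx)))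
      (hs _ _ (Submodule.sub_mem _
        (by simpa using hg.insFamily 𝔹.hasDegree _ _ hx)
        (by simpa using 𝔸.hasDegree.compFamily hg _ _ hx)))
  have hsign : ∀ xs, h (xs.map G'.sign) = G.sign (h xs) := fun xs => by
    simp [hdeg.map_sign hmul]
  have hnil : h [] = 0 := by
    rw [hrec]
    simp [T, E, idFamily, f.nil, 𝔸.nil, 𝔹.nil, truncate]
  have hcomp : ∀ xs, compFamily f.f h xs = idFamily xs := by
    intro xs
    rcases eq_or_ne xs [] with rfl | hxs
    · simp [f.nil, idFamily]
    · rw [compFamily_eq_add_truncate f.multilinear h hxs]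
      change f.linear (h xs) + _ = _
      rw [hrec, map_add, hfι, hfs]
      simp
  have hδ : ∀ n, ∀ xs : List B, xs.length = n →
      compFamily 𝔸.m h xs = insFamily G'.sign h 𝔹.m xs := by
    intro n
    induction n using Nat.strong_induction_on with
    | _ n ih =>
      intro xs hn
      have hlt : ∀ u : List B, u.length < xs.length →
          compFamily 𝔸.m h u = insFamily G'.sign h 𝔹.m u := fun u hu => ih _ (hn ▸ hu) u rfl
      rcases eq_or_ne xs [] with rfl | hxs
      · have h0 : h [0] = 0 := hmul.map_zero_entry [] []
        simp [𝔸.nil, 𝔹.nil, h0]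
      set e := E (truncate xs.length h) xs with he
      have hdefect : compFamily 𝔸.m h xs - insFamily G'.sign h 𝔹.m xs = 𝔸.d (h xs) - e := by
        rw [compFamily_eq_add_truncate 𝔸.multilinear h hxs,
          insFamily_eq_truncate hmul _ 𝔹.nil hmin, he, Alg.d_apply]
        simp only [E]
        abel
      -- Since `f` is a morphism and `f ∘ h = id`, both sides of the obstruction difference for `F =
      -- f` are `m` of the minimal algebra; hence `f₁(d h_n - e) = 0`, while `f₁ d = 0`.
      have hfe : f.linear e = 0 := by
        have h₁ := compFamily_insFamily_of_forall_lt (τ := G.sign) f.multilinear 𝔹.nil 𝔸.nil hmul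
          hsign xs hlt
        have h₂ : insFamily G.sign f.f 𝔸.m = compFamily 𝔹.m f.f := funext f.insFamily_eq
        rw [h₂, compFamily_comp 𝔹.multilinear, funext hcomp, compFamily_idFamily 𝔹.multilinear,
          insFamily_idFamily, sub_self, hdefect] at h₁
        change 0 = f.linear _ at h₁
        rw [map_sub, f.linear_d_of_isMinimal hmin, zero_sub, zero_eq_neg] at h₁
        exact h₁
      -- For `F = m`, the first term dies by `m ∘ m̂ = 0` in `A`. By minimality the second sees `m ∘
      -- ĥ` only on shorter lists, where it equals `h ∘ m̂`, and then `m̂ ∘ m̂ = 0` applies.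
      have hde : 𝔸.d e = 0 := by
        have h₁ := compFamily_insFamily_of_forall_lt (τ := G.sign) 𝔸.multilinear 𝔹.nil 𝔸.nil hmul
          hsign xs hlt
        have h₂ : insFamily G.sign 𝔸.m 𝔸.m = fun _ => 0 := funext 𝔸.insFamily_self
        have h₃ : truncate xs.length (compFamily 𝔸.m h) =
            truncate xs.length (insFamily G'.sign h 𝔹.m) := by
          funext l
          by_cases hl : l.length < xs.length
          · rw [truncate_of_lt _ hl, truncate_of_lt _ hl, hlt l hl]
          · rw [truncate_of_le _ (by omega), truncate_of_le _ (by omega)]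
        rw [h₂, compFamily_zero,
          insFamily_eq_truncate (𝔸.multilinear.compFamily hmul) _ 𝔹.nil hmin, h₃,
          ← insFamily_eq_truncate (hmul.insFamily _ 𝔹.multilinear 𝔹.nil) _ 𝔹.nil hmin,
          insFamily_insFamily hmul G'.sign_sign 𝔹.multilinear 𝔹.nil 𝔹.map_sign
            𝔹.insFamily_self, sub_self, hdefect] at h₁
        change 0 = 𝔸.d _ at h₁
        rw [map_sub, 𝔸.d_d, zero_sub, zero_eq_neg] at h₁
        exact h₁
      rw [← sub_eq_zero, hdefect, hrec, map_add, hdι, hds _ hde hfe, zero_add, sub_self]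
  exact ⟨⟨h, hmul, hnil, fun ds xs hx => by simpa using hdeg ds xs hx,
    fun xs => (hδ _ xs rfl).symm⟩, funext hcomp⟩

theorem Hom.IsQuasiIso.of_rightInverse {f : Hom 𝔸 𝔹} (hf : f.IsQuasiIso) {h : Hom 𝔹 𝔸}
    (hfh : compFamily f.f h.f = idFamily) : h.IsQuasiIso := by
  have h₁ : ∀ x, f.linear (h.linear x) = x := fun x => by
    have := congrFun hfh [x]
    simp only [compFamily_cons, splitSum_nil, compFamily_nil, idFamily] at this
    exact this
  have h₂ : f.cohMap ∘ h.cohMap = id := by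
    funext c
    obtain ⟨z, rfl⟩ := Submodule.mkQ_surjective _ c
    exact congrArg 𝔹.toCoh (Subtype.ext (h₁ z))
  refine (Function.Bijective.of_comp_iff' hf _).1 ?_
  rw [h₂]
  exact Function.bijective_id

end QuasiIso

/-! ### Functoriality of the pullback of inner products. -/

section Pullback

theorem sum_map_comm {ι ι' M : Type*} [AddCommMonoid M] (l : List ι) (l' : List ι')
    (g : ι → ι' → M) :
    (l.map fun i => (l'.map fun j => g i j).sum).sum =
      (l'.map fun j => (l.map fun i => g i j).sum).sum := by
  induction l with
  | nil => simp
  | cons i l ih => simp [ih, List.sum_map_add]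

/-- Both sides run over `a = a₁ c₁ c₂ a₄`, nested as `a₁ ((c₁ c₂) a₄)` and as `(a₁ c₁) (c₂ a₄)`: the
cuts made by two successive pullbacks and by one pullback along the composite. -/
theorem splitSum_regroup_left {α M : Type*} [AddCommMonoid M]
    (Θ : List α → List α → List α → List α → M) (a : List α) :
    splitSum (fun a₁ a' => splitSum (fun a₃ a₄ => splitSum (fun c₁ c₂ => Θ a₁ c₁ c₂ a₄) a₃) a') a =
      splitSum (fun u v => splitSum (fun c₂ a₄ => splitSum (fun a₁ c₁ => Θ a₁ c₁ c₂ a₄) u) v)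
        a := by
  simp only [← splitSum_assoc fun c₁ c₂ a₄ => Θ _ c₁ c₂ a₄]
  rw [splitSum_assoc fun a₁ c₁ v => splitSum (fun c₂ a₄ => Θ a₁ c₁ c₂ a₄) v]
  exact splitSum_congr fun u v _ => splitSum_comm (fun a₁ c₁ c₂ a₄ => Θ a₁ c₁ c₂ a₄) u v

theorem splitSum_regroup_right {α M : Type*} [AddCommMonoid M]
    (Θ : List α → List α → List α → List α → M) (b : List α) :
    splitSum (fun b' b₂ => splitSum (fun b₃ b₄ => splitSum (fun d₁ d₂ => Θ b₃ d₁ d₂ b₂) b₄) b') b =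
      splitSum (fun u v => splitSum (fun b₃ d₁ => splitSum (fun d₂ b₂ => Θ b₃ d₁ d₂ b₂) v) u)
        b := by
  simp only [splitSum_assoc fun b₃ d₁ d₂ => Θ b₃ d₁ d₂ _]
  rw [← splitSum_assoc fun u d₂ b₂ => splitSum (fun b₃ d₁ => Θ b₃ d₁ d₂ b₂) u]
  exact splitSum_congr fun u v _ => splitSum_comm (fun d₂ b₂ b₃ d₁ => Θ b₃ d₁ d₂ b₂) v u

variable {k : Type*} [Field k] {A B : Type*} [AddCommGroup A] [Module k A]
  [AddCommGroup B] [Module k B] {G : Grading k A} {G' : Grading k B} {𝔸 : Alg G} {𝔹 : Alg G'}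

theorem sum_map_apply {M N ι : Type*} [AddCommGroup M] [Module k M] [AddCommGroup N] [Module k N]
    (l : List ι) (g : ι → M →ₗ[k] N) (v : M) : (l.map g).sum v = (l.map fun i => g i v).sum := by
  induction l with
  | nil => simp
  | cons i l ih => simp [ih]

theorem BiFamily.comp_apply {M N P : Type*} [AddCommGroup M] [Module k M] [AddCommGroup N]
    [Module k N] [AddCommGroup P] [Module k P] (ψ : BiFamily k A N P) (D : ℤ)
    (φ : BiFamily k A M N) (a b : List A) (v : M) :
    BiFamily.comp G ψ D φ a b v = splitSum (fun a₁ a₂ => splitSum (fun b₁ b₂ =>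
      ψ (a₁.map (G.sign ^ D.natAbs : Module.End k A)) b₂ (φ a₂ b₁ v)) b) a := by
  simp only [BiFamily.comp, sum_map_apply]
  rfl

theorem Hom.restrict_apply (f : Hom 𝔸 𝔹) {M N : Type*} [AddCommGroup M] [Module k M]
    [AddCommGroup N] [Module k N] (ψ : BiFamily k B M N) (a b : List A) (v : M) :
    f.restrict ψ a b v =
      compFamily (fun P => compFamily (fun Q => ψ P Q v) f.f b) f.f a := by
  simp only [Hom.restrict, sum_map_apply]
  rfl

theorem Hom.pullback_apply (f : Hom 𝔸 𝔹) (D : ℤ) (ψ : BiFamily k B B (Module.Dual k B))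
    (a b : List A) (v w : A) :
    f.pullback D ψ a b v w = splitSum (fun a₁ a' => splitSum (fun b' b₂ =>
      splitSum (fun a₃ a₄ => splitSum (fun b₃ b₄ =>
        compFamily (fun P => compFamily (fun Q => ψ P Q (f.f (a₄ ++ v :: b₃))
          (f.f (b₂ ++ w :: a₁.map (G.sign ∘ₗ (G.sign ^ D.natAbs : Module.End k A)))))
            f.f b₄) f.f a₃) b') a') b) a := by
  simp only [Hom.pullback, BiFamily.comp_apply, BiFamily.dual, Hom.tilde, Hom.restrict_apply,
    splitSum, compFamily, sum_map_apply, LinearMap.dualMap_apply, IsLinearMap.mk'_apply,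
    List.map_map, Int.natAbs_zero, pow_zero, Module.End.one_eq_id, LinearMap.id_coe, List.map_id,
    LinearMap.coe_comp]

theorem compFamily_of_cons_eq_zero {M : Type*} [AddCommGroup M] {F : List B → M}
    (hF : ∀ y l, F (y :: l) = 0) (h : List A → B) {xs : List A} (hxs : xs ≠ []) :
    compFamily F h xs = 0 := by
  obtain ⟨x, xs, rfl⟩ := List.exists_cons_of_ne_nil hxs
  rw [compFamily_cons]
  simp only [hF, compFamily_zero, splitSum_zero]

theorem splitSum_eq_empty_right {α M : Type*} [AddCommMonoid M] {Φ : List α → List α → M}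
    {xs : List α} (h : ∀ u v, v ≠ [] → Φ u v = 0) : splitSum Φ xs = Φ xs [] :=
  splitSum_eq_full fun u v huv hu => h u v (by rintro rfl; simp at huv; simp [huv] at hu)

theorem cyclicFamily_cons_left (ω : B →ₗ[k] Module.Dual k B) (x : B) (P Q : List B) :
    cyclicFamily ω (x :: P) Q = 0 := rfl

theorem cyclicFamily_cons_right (ω : B →ₗ[k] Module.Dual k B) (x : B) (P Q : List B) :
    cyclicFamily ω P (x :: Q) = 0 := by
  cases P <;> rfl

/-- A constant family has no arguments beside the bimodule slot, so nothing may be left over for the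
blocks on either side. -/
theorem compFamily_cyclicFamily (ω : B →ₗ[k] Module.Dual k B) (h : List A → B) (a b : List A)
    (X : List A → List A → B) (y : B) :
    splitSum (fun a₃ a₄ => splitSum (fun b₃ b₄ => compFamily (fun P => compFamily (fun Q =>
      cyclicFamily ω P Q (X a₄ b₃) y) h b₄) h a₃) b) a = ω (X a b) y := by
  rw [splitSum_eq_empty, splitSum_eq_empty_right]
  · rw [compFamily_nil, compFamily_nil]
    rfl
  · intro u v hv
    rw [compFamily_nil, compFamily_of_cons_eq_zero _ _ hv]
    intro y l
    rw [cyclicFamily_cons_right]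
    rfl
  · intro u v _ hu
    refine splitSum_eq_zero fun p q _ => compFamily_of_cons_eq_zero (fun y l => ?_) _ hu
    simp only [cyclicFamily_cons_left, LinearMap.zero_apply, compFamily_zero]

theorem Hom.pullback_cyclicFamily (f : Hom 𝔸 𝔹) (D : ℤ) (ω : B →ₗ[k] Module.Dual k B)
    (a b : List A) (v w : A) :
    f.pullback D (cyclicFamily ω) a b v w = splitSum (fun a₁ a₂ => splitSum (fun b₁ b₂ =>
      ω (f.f (a₂ ++ v :: b₁))
        (f.f (b₂ ++ w :: a₁.map (G.sign ∘ₗ (G.sign ^ D.natAbs : Module.End k A))))) b) a := by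
  rw [f.pullback_apply]
  exact splitSum_congr fun a₁ a' _ => splitSum_congr fun b' b₂ _ =>
    compFamily_cyclicFamily ω f.f a' b' (fun a₄ b₃ => f.f (a₄ ++ v :: b₃)) _

theorem Hom.map_map_sign_pow (h : Hom 𝔸 𝔹) (N : ℕ) (xs : List A) :
    h.f (xs.map (G.sign ^ N : Module.End k A)) =
      (G'.sign ^ N : Module.End k B) (h.f xs) := by
  induction N generalizing xs with
  | zero => simp [Module.End.one_eq_id]
  | succ N ih =>
    have e : xs.map (G.sign ^ (N + 1) : Module.End k A) =
        (xs.map G.sign).map (G.sign ^ N : Module.End k A) := by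
      rw [List.map_map, pow_succ]; rfl
    rw [e, ih, h.map_sign, pow_succ]
    rfl

theorem Hom.map_map_sign_comp_pow (h : Hom 𝔸 𝔹) (N : ℕ) (xs : List A) :
    h.f (xs.map (G.sign ∘ₗ (G.sign ^ N : Module.End k A))) =
      (G'.sign ∘ₗ (G'.sign ^ N : Module.End k B)) (h.f xs) := by
  rw [LinearMap.comp_apply, ← h.map_map_sign_pow, ← h.map_sign, List.map_map]
  rfl

theorem compFamily_comm {A' B' M : Type*} [AddCommGroup M] (F : List B → List B' → M)
    (h : List A → B) (h' : List A' → B') (a : List A) (b : List A') :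
    compFamily (fun P => compFamily (fun Q => F P Q) h' b) h a =
      compFamily (fun Q => compFamily (fun P => F P Q) h a) h' b :=
  sum_map_comm _ _ _

theorem compFamily_splitSum_comm {α M : Type*} [AddCommGroup M] (Φ : List B → List α → List α → M)
    (h : List A → B) (a : List A) (b : List α) :
    compFamily (fun P => splitSum (fun u v => Φ P u v) b) h a =
      splitSum (fun u v => compFamily (fun P => Φ P u v) h a) b :=
  sum_map_comm _ _ _

theorem compFamily_compFamily_splitSum {M : Type*} [AddCommGroup M]
    (Ω : List B → List B → List B → List B → M) (h : List A → B) (a b : List A) :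
    compFamily (fun P => compFamily (fun Q => splitSum (fun P₁ P₂ => splitSum (fun Q₁ Q₂ =>
      Ω P₁ P₂ Q₁ Q₂) Q) P) h b) h a =
    splitSum (fun c₁ c₂ => splitSum (fun d₁ d₂ => compFamily (fun P₁ => compFamily (fun P₂ =>
      compFamily (fun Q₁ => compFamily (fun Q₂ => Ω P₁ P₂ Q₁ Q₂) h d₂) h d₁) h c₂) h c₁) b) a := by
  have e : ∀ P, compFamily (fun Q => splitSum (fun P₁ P₂ => splitSum (fun Q₁ Q₂ =>
      Ω P₁ P₂ Q₁ Q₂) Q) P) h b = splitSum (fun P₁ P₂ => splitSum (fun d₁ d₂ =>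
        compFamily (fun Q₁ => compFamily (fun Q₂ => Ω P₁ P₂ Q₁ Q₂) h d₂) h d₁) b) P := fun P => by
    rw [compFamily_splitSum_comm]
    exact splitSum_congr fun P₁ P₂ _ => compFamily_splitSum _ _ _
  simp only [e]
  refine (compFamily_splitSum _ _ _).trans ?_
  simp only [compFamily_splitSum_comm]

theorem compFamily_map {M : Type*} [AddCommGroup M] (F : List B → M) {h : List A → B} {ρ : A → A}
    {ρ' : B → B} (hρ : ∀ xs, h (xs.map ρ) = ρ' (h xs)) (xs : List A) :
    compFamily F h (xs.map ρ) = compFamily (fun l => F (l.map ρ')) h xs := by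
  induction hn : xs.length using Nat.strong_induction_on generalizing xs F with
  | _ n ih =>
    cases xs with
    | nil => simp
    | cons x xs =>
      rw [List.map_cons, compFamily_cons, compFamily_cons, splitSum_map]
      refine splitSum_congr fun u v huv => ?_
      rw [ih v.length (by subst huv hn; simp) _ v rfl, ← List.map_cons, hρ]
      rfl

/-- Functoriality of the pullback of a constant inner product. -/
theorem Hom.pullback_pullback (f : Hom 𝔸 𝔹) (h : Hom 𝔹 𝔸) (D : ℤ) (ω : B →ₗ[k] Module.Dual k B)
    (a b : List B) (v w : B) :
    h.pullback D (f.pullback D (cyclicFamily ω)) a b v w =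
      splitSum (fun a₁ a₂ => splitSum (fun b₁ b₂ =>
        ω (compFamily f.f h.f (a₂ ++ v :: b₁)) (compFamily f.f h.f
          (b₂ ++ w :: a₁.map (G'.sign ∘ₗ (G'.sign ^ D.natAbs : Module.End k B))))) b) a := by
  set ρ := G.sign ∘ₗ (G.sign ^ D.natAbs : Module.End k A) with hρ
  set ρ' := G'.sign ∘ₗ (G'.sign ^ D.natAbs : Module.End k B) with hρ'
  -- The common summand for `a = a₁ c₁ c₂ a₄` and `b = b₃ d₁ d₂ b₂`: the `h`-blocks of `c₂` and `d₁`
  -- join `v` in the first `f`, while those of `d₂` and the signed ones of `c₁` join `w` in the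
  -- second.
  let Ψ : List B → List B → List B → List B → List B → List B → List B → List B → k :=
    fun a₁ c₁ c₂ a₄ b₃ d₁ d₂ b₂ =>
      compFamily (fun P₁ => compFamily (fun P₂ => compFamily (fun Q₁ => compFamily (fun Q₂ =>
        ω (f.f (P₂ ++ h.f (a₄ ++ v :: b₃) :: Q₁))
          (f.f (Q₂ ++ h.f (b₂ ++ w :: a₁.map ρ') :: P₁.map ρ))) h.f d₂) h.f d₁) h.f c₂) h.f c₁
  have hL : h.pullback D (f.pullback D (cyclicFamily ω)) a b v w =
      splitSum (fun a₁ a' => splitSum (fun b' b₂ => splitSum (fun a₃ a₄ =>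
        splitSum (fun b₃ b₄ => splitSum (fun c₁ c₂ => splitSum (fun d₁ d₂ =>
          Ψ a₁ c₁ c₂ a₄ b₃ d₁ d₂ b₂) b₄) a₃) b') a') b) a := by
    rw [h.pullback_apply]
    refine splitSum_congr fun a₁ a' _ => splitSum_congr fun b' b₂ _ => splitSum_congr
      fun a₃ a₄ _ => splitSum_congr fun b₃ b₄ _ => ?_
    simp only [f.pullback_cyclicFamily]
    exact compFamily_compFamily_splitSum _ _ _ _
  -- Each composite is expanded around its marked entry; the signs on `a₁` pass through `h`, which
  -- has degree `0`.
  have hR : ∀ a₁ a₂ b₁ b₂, ω (compFamily f.f h.f (a₂ ++ v :: b₁))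
        (compFamily f.f h.f (b₂ ++ w :: a₁.map ρ')) =
      splitSum (fun c₂ a₄ => splitSum (fun a₁ c₁ => splitSum (fun b₃ d₁ => splitSum (fun d₂ b₂ =>
        Ψ a₁ c₁ c₂ a₄ b₃ d₁ d₂ b₂) b₂) b₁) a₁) a₂ := by
    intro a₁ a₂ b₁ b₂
    have hρm : ∀ xs, h.f (xs.map ρ') = ρ (h.f xs) := h.map_map_sign_comp_pow D.natAbs
    have l₁ : ∀ z, IsLinearMap k fun y => ω y z := fun z => (ω.flip z).isLinear
    have l₂ : ∀ y, IsLinearMap k fun z => ω y z := fun y => (ω y).isLinear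
    rw [compFamily_append_cons, compFamily_append_cons, IsLinearMap.map_splitSum (l₁ _)]
    simp only [IsLinearMap.map_splitSum (l₁ _), IsLinearMap.map_compFamily (l₁ _),
      IsLinearMap.map_splitSum (l₂ _), IsLinearMap.map_compFamily (l₂ _), splitSum_map,
      compFamily_map _ hρm, compFamily_splitSum_comm, Ψ]
    refine splitSum_congr fun c₂ a₄ _ => ?_
    rw [splitSum_comm _ a₁]
    refine splitSum_congr fun b₃ d₁ _ => ?_
    rw [splitSum_comm _ a₁]
    refine splitSum_congr fun d₂ b₂ _ => splitSum_congr fun a₁ c₁ _ => ?_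
    rw [compFamily_comm _ h.f h.f c₁]
    congr 1
    funext P₂
    rw [compFamily_comm _ h.f h.f c₁]
    congr 1
    funext Q₁
    rw [compFamily_comm _ h.f h.f c₁]
  rw [hL]
  simp only [hR]
  have e₁ : ∀ a₁ a', splitSum (fun b' b₂ => splitSum (fun a₃ a₄ =>
        splitSum (fun b₃ b₄ => splitSum (fun c₁ c₂ => splitSum (fun d₁ d₂ =>
          Ψ a₁ c₁ c₂ a₄ b₃ d₁ d₂ b₂) b₄) a₃) b') a') b =
      splitSum (fun a₃ a₄ => splitSum (fun c₁ c₂ => splitSum (fun b' b₂ =>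
        splitSum (fun b₃ b₄ => splitSum (fun d₁ d₂ =>
          Ψ a₁ c₁ c₂ a₄ b₃ d₁ d₂ b₂) b₄) b') b) a₃) a' := by
    intro a₁ a'
    rw [splitSum_comm]
    refine splitSum_congr fun a₃ a₄ _ => ?_
    rw [splitSum_comm]
    exact splitSum_congr fun b' b₂ _ => splitSum_comm _ _ _
  have e₂ : ∀ u u', splitSum (fun b₁ b₂ => splitSum (fun c₂ a₄ => splitSum (fun a₁ c₁ =>
        splitSum (fun b₃ d₁ => splitSum (fun d₂ b₂ =>
        Ψ a₁ c₁ c₂ a₄ b₃ d₁ d₂ b₂) b₂) b₁) u) u') b =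
      splitSum (fun c₂ a₄ => splitSum (fun a₁ c₁ => splitSum (fun b₁ b₂ =>
        splitSum (fun b₃ d₁ => splitSum (fun d₂ b₂ =>
        Ψ a₁ c₁ c₂ a₄ b₃ d₁ d₂ b₂) b₂) b₁) b) u) u' := by
    intro u u'
    rw [splitSum_comm]
    refine splitSum_congr fun c₂ a₄ _ => ?_
    rw [splitSum_comm]
  rw [splitSum_congr fun a₁ a' _ => e₁ a₁ a', splitSum_congr fun u u' _ => e₂ u u',
    splitSum_regroup_left]
  refine splitSum_congr fun _ _ _ => splitSum_congr fun _ _ _ => splitSum_congr fun _ _ _ => ?_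
  exact splitSum_regroup_right _ _

theorem Hom.pullback_eq_cyclicFamily {f : Hom 𝔸 𝔹} {h : Hom 𝔹 𝔸}
    (hfh : compFamily f.f h.f = idFamily) (D : ℤ) (ω : B →ₗ[k] Module.Dual k B) :
    h.pullback D (f.pullback D (cyclicFamily ω)) = cyclicFamily ω := by
  have hid : ∀ (a b : List B) (v : B), a ≠ [] → idFamily (a ++ v :: b) = 0 := by
    intro a b v ha
    rcases a with _ | ⟨x, _ | ⟨y, a⟩⟩
    · exact absurd rfl ha
    · rfl
    · rfl
  funext a b
  ext v w
  -- The identity has only a linear component, so the slot of `v` takes nothing from `a` or `b`, and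
  -- all of both lands beside `w`, where it must be empty as well.
  rw [Hom.pullback_pullback, hfh, splitSum_eq_full, splitSum_eq_empty]
  · rcases a with _ | ⟨x, a⟩
    · rcases b with _ | ⟨y, b⟩
      · rfl
      · have : idFamily (y :: b ++ [w]) = (0 : B) := hid _ _ _ (by simp)
        rw [cyclicFamily_cons_right, List.map_nil, this, map_zero]
        rfl
    · have : ∀ z : B, idFamily (w :: z :: a.map (G'.sign ∘ₗ (G'.sign ^ D.natAbs :
          Module.End k B))) = 0 := fun z => rfl
      rw [cyclicFamily_cons_left]
      rcases b with _ | ⟨y, b⟩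
      · simp only [List.map_cons, List.nil_append]
        rw [this, map_zero]
        rfl
      · rw [hid (y :: b) _ w (by simp), map_zero]
        rfl
  · rintro u v' - hu
    obtain ⟨y, u, rfl⟩ := List.exists_cons_of_ne_nil hu
    have : idFamily ([] ++ v :: y :: u) = (0 : B) := rfl
    rw [this, map_zero, LinearMap.zero_apply]
  · intro u v' huv hu
    have hv' : v' ≠ [] := by rintro rfl; simp at huv; simp [huv] at hu
    refine splitSum_eq_zero fun p q _ => ?_
    rw [hid _ _ _ hv', map_zero, LinearMap.zero_apply]

end Pullback

end AInfty

theorem mainTheorem6 {k : Type*} [Field k] {A : Type*} [AddCommGroup A] [Module k A]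
    {G : AInfty.Grading k A} (𝔸 : AInfty.Alg G)
    (D : ℤ) (φ : AInfty.BiFamily k A A (Module.Dual k A))
    (hφ : AInfty.IsStrongHomotopyInnerProduct 𝔸 D φ)
    (ℌ : AInfty.Alg 𝔸.cohGrading) (hmin : ℌ.IsMinimal)
    (ω : 𝔸.Coh →ₗ[k] Module.Dual k 𝔸.Coh) (hω : AInfty.IsCyclicInnerProduct ℌ D ω)
    (f : AInfty.Hom 𝔸 ℌ) (hf : f.IsQuasiIso)
    (hcomm : φ = f.pullback D (AInfty.cyclicFamily ω)) :
    ∃ h : AInfty.Hom ℌ 𝔸, h.IsQuasiIso ∧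
      AInfty.compFamily f.f h.f = AInfty.idFamily ∧
      AInfty.cyclicFamily ω = h.pullback D φ := by
  obtain ⟨h, hfh⟩ := hf.exists_rightInverse hmin
  exact ⟨h, hf.of_rightInverse hfh, hfh, by rw [hcomm, AInfty.Hom.pullback_eq_cyclicFamily hfh]⟩
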